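/- Let $n\ge 2$, $0\le d\le n$, and let $\widetilde G^n_d$ be the oriented Grassmannian of $d$-dimensional oriented linear subspaces of $\mathbb R^n$. An (oriented) $d$-varifold is a nonnegative finite Radon measure $\mu$ on $\mathbb R^n\times\widetilde G^n_d$; its weight $|\mu|$ is its image on $\mathbb R^n$. For a $C^1$-diffeomorphism $\varphi$ of $\mathbb R^n$, let $J_U\varphi(x)$ be the Jacobian of $\varphi$ at $x$ along $U$, that is $J_U\varphi(x)=\sqrt{\det(d_x\varphi(u_i)\cdot d_x\varphi(u_j))_{i,j}}$ for any orthonormal frame $(u_i)$ of $U$, and let $\varphi_\#\mu$ be the varifold with $\int\omega\,d(\varphi_\#\mu)=\int\omega(\varphi(x),d_x\varphi\cdot U)\,J_U\varphi(x)\,d\mu(x,U)$ for all $\omega\in C_0(\mathbb R^n\times\widetilde G^n_d)$. Let $V$ be a Hilbert space of vector fields on $\mathbb R^n$, continuously embedded in $C^2_0(\mathbb R^n,\mathbb R^n)$ (the $C^2$ vector fields that vanish at infinity with their first and second derivatives). For $v\in L^2([0,1],V)$ let $\varphi^v_t$ be its flow, $\varphi^v_t(x)=x+\int_0^t v_s(\varphi^v_s(x))\,ds$.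 For $\eta\in L^2([0,1],L^2(|\mu|))$ let $\tilde\alpha^\eta_t=1+\tfrac12\int_0^t\eta_s\,ds$ and $\mu_t=\big((\tilde\alpha^\eta_t)^2\circ(\varphi^v_t)^{-1}\big)\,(\varphi^v_t)_\#\mu$. Let $k$ be a positive definite kernel on $\mathbb R^n\times\widetilde G^n_d$ with reproducing kernel Hilbert space $W$, and put $\|\nu-\nu'\|_{W^*}=\sup_{\|\omega\|_W\le1}\big(\int\omega\,d\nu'-\int\omega\,d\nu\big)$ for varifolds $\nu,\nu'$. Assume that $k(x,U,x',U')\ge0$ and $k(x,U,x,U)>0$ for all $x,x'\in\mathbb R^n$ and $U,U'\in\widetilde G^n_d$, and that $W$ is continuously embedded in $C^1_0(\mathbb R^n\times\widetilde G^n_d)$ (the $C^1$ functions that vanish at infinity with their differential). Let $\gamma,\lambda>0$, let $\mu=\sum_{i=1}^N r_i\,\delta_{(x_i,U_i)}$ be a discrete varifold with $r_i>0$, and let $\mu'$ be any $d$-varifold. Then the problem of minimizing $$\frac12\int_0^1\|v_t\|_V^2\,dt+\frac\gamma2\int_0^1\int_{\mathbb R^n\times\widetilde G^n_d}\eta_t(x)^2\,J_U\varphi^v_t(x)\,d\mu(x,U)\,dt+\frac\lambda2\,\|\mu_1-\mu'\|_{W^*}^2$$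 over all $v\in L^2([0,1],V)$ and $\eta\in L^2([0,1],L^2(|\mu|))$ has a solution $(v,\eta)$. Moreover, there is a solution with $\tilde\alpha^\eta_t\ge0$ $|\mu|$-almost everywhere for every $t\in[0,1]$, so that it also solves the problem restricted to such $\eta$. -/

import Mathlib

open MeasureTheory Filter Topology Set

noncomputable section

/-- The ambient Euclidean space `ℝⁿ`. -/
abbrev Eucl (n : ℕ) : Type := EuclideanSpace ℝ (Fin n)

/-! ### The oriented Grassmannian -/

/-- Frames of `d` linearly independent vectors of `ℝⁿ`. -/
abbrev Frame (n d : ℕ) : Type := {u : Fin d → Eucl n // LinearIndependent ℝ u}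

/-- If `w_j = ∑ᵢ R i j • u_i`, the Gram matrix of `w` is `Rᵀ G R`, where `G` is that of `u`. -/
theorem gram_comb {n d : ℕ} (u w : Fin d → Eucl n) (R : Matrix (Fin d) (Fin d) ℝ)
    (h : ∀ j, w j = ∑ i, R i j • u i) :
    Matrix.gram ℝ w = R.transpose * Matrix.gram ℝ u * R := by
  ext a b
  simp only [Matrix.gram, Matrix.of_apply, h, Matrix.mul_apply, Matrix.transpose_apply,
    sum_inner, inner_sum, inner_smul_left, inner_smul_right, Finset.sum_mul]
  refine Finset.sum_congr rfl fun i _ => ?_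
  rw [Finset.mul_sum]
  refine Finset.sum_congr rfl fun j _ => ?_
  simp
  ring

/-- Two frames span the same oriented subspace when the change of frame has positive determinant. -/
def frameSetoid (n d : ℕ) : Setoid (Frame n d) where
  r u w := ∃ R : Matrix (Fin d) (Fin d) ℝ, 0 < R.det ∧ ∀ j, w.1 j = ∑ i, R i j • u.1 i
  iseqv :=
    { refl := fun u => ⟨1, by simp, fun j => by simp [Matrix.one_apply]⟩
      symm := by
        rintro u w ⟨R, hR, h⟩
        refine ⟨R⁻¹, by rw [Matrix.det_nonsing_inv]; simpa using hR, fun j => ?_⟩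
        have hRR : R * R⁻¹ = 1 := Matrix.mul_nonsing_inv _ (isUnit_iff_ne_zero.2 hR.ne')
        simp only [h, Finset.smul_sum, smul_smul]
        rw [Finset.sum_comm]
        have : ∀ i, ∑ k, (R⁻¹ k j * R i k) • u.1 i = (1 : Matrix (Fin d) (Fin d) ℝ) i j • u.1 i := by
          intro i
          rw [← Finset.sum_smul, ← hRR, Matrix.mul_apply]
          simp only [mul_comm]
        simp [this, Matrix.one_apply]
      trans := by
        rintro u w z ⟨R, hR, h⟩ ⟨S, hS, h'⟩
        refine ⟨R * S, by rw [Matrix.det_mul]; positivity, fun j => ?_⟩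
        simp only [h', h, Finset.smul_sum, smul_smul]
        rw [Finset.sum_comm]
        refine Finset.sum_congr rfl fun i _ => ?_
        rw [← Finset.sum_smul, Matrix.mul_apply]
        simp only [mul_comm] }

/-- The oriented Grassmannian of `d`-dimensional oriented linear subspaces of `ℝⁿ`. -/
def OGrass (n d : ℕ) : Type := Quotient (frameSetoid n d)

namespace OGrass

variable {n d : ℕ}

/-- The oriented subspace spanned by a frame. -/
def span (u : Frame n d) : OGrass n d := Quotient.mk (frameSetoid n d) u

/-- The quotient topology from the open set of frames in `(ℝⁿ)ᵈ`. -/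
instance : TopologicalSpace (OGrass n d) :=
  inferInstanceAs (TopologicalSpace (Quotient (frameSetoid n d)))

instance : MeasurableSpace (OGrass n d) := borel _

instance : BorelSpace (OGrass n d) := ⟨rfl⟩

open Classical in
/-- The image `A · U` of an oriented subspace by an injective linear map `A`, spanned by the images
of the vectors of a frame of `U` (by convention `U` itself if `A` is not injective). -/
def map (A : Eucl n →L[ℝ] Eucl n) (U : OGrass n d) : OGrass n d :=
  if hA : Function.Injective A then
    Quotient.lift (s := frameSetoid n d)
      (fun u => span ⟨fun i => A (u.1 i),
        u.2.map' (A : Eucl n →ₗ[ℝ] Eucl n) (LinearMap.ker_eq_bot.2 hA)⟩)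
      (by
        rintro u w ⟨R, hR, h⟩
        refine Quotient.sound (s := frameSetoid n d) ⟨R, hR, fun j => ?_⟩
        simp [h]) U
  else U

/-- The change of `d`-volume `J_U A` of a linear map `A` along `U`: for any frame `u` of `U`, the
ratio of the `d`-volumes of `(A u_i)` and `(u_i)`, so `√det (A u_i · A u_j)` if `u` is
orthonormal. -/
def jac (A : Eucl n →L[ℝ] Eucl n) (U : OGrass n d) : ℝ :=
  Quotient.lift (s := frameSetoid n d)
    (fun u => √((Matrix.gram ℝ fun i => A (u.1 i)).det / (Matrix.gram ℝ u.1).det))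
    (by
      rintro u w ⟨R, hR, h⟩
      have h2 : ∀ j, A (w.1 j) = ∑ i, R i j • A (u.1 i) := fun j => by simp [h]
      have hR2 : R.det ≠ 0 := hR.ne'
      simp only [gram_comb _ _ R h, gram_comb _ _ R h2, Matrix.det_mul, Matrix.det_transpose]
      congr 1
      by_cases hz : (Matrix.gram ℝ u.1).det = 0
      · simp [hz]
      · field_simp) U

end OGrass

/-! ### Varifolds -/

/-- The space `ℝⁿ × G̃` that carries the varifolds; an oriented `d`-varifold is a finite measure
on it. -/
abbrev VSpace (n d : ℕ) : Type := Eucl n × OGrass n d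

/-- The weight `|μ|` of a varifold: its image on `ℝⁿ`. -/
abbrev weight {n d : ℕ} (μ : Measure (VSpace n d)) : Measure (Eucl n) := μ.map Prod.fst

/-- The discrete varifold `∑ᵢ rᵢ δ_(xᵢ, Uᵢ)`. -/
def discreteVarifold {n d N : ℕ} (r : Fin N → ℝ) (x : Fin N → Eucl n) (U : Fin N → OGrass n d) :
    Measure (VSpace n d) :=
  ∑ i, ENNReal.ofReal (r i) • Measure.dirac (x i, U i)

/-- The rescaled varifold `α μ`. -/
def rescale {n d : ℕ} (α : Eucl n → ℝ) (μ : Measure (VSpace n d)) : Measure (VSpace n d) :=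
  μ.withDensity fun p => ENNReal.ofReal (α p.1)

/-- The pushforward `φ_# μ` of a varifold: `(φ_# μ | ω) = ∫ ω(φ x, d_xφ · U) J_U φ(x) dμ(x, U)`. -/
def varifoldPush {n d : ℕ} (φ : Eucl n → Eucl n) (μ : Measure (VSpace n d)) :
    Measure (VSpace n d) :=
  (μ.withDensity fun p => ENNReal.ofReal (OGrass.jac (fderiv ℝ φ p.1) p.2)).map
    fun p => (φ p.1, OGrass.map (fderiv ℝ φ p.1) p.2)

/-- The action `(φ, α) · μ = φ_# (α μ) = (α ∘ φ⁻¹) φ_# μ`. -/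
def metaAction {n d : ℕ} (φ : Eucl n → Eucl n) (α : Eucl n → ℝ) (μ : Measure (VSpace n d)) :
    Measure (VSpace n d) :=
  varifoldPush φ (rescale α μ)

/-! ### Deformations and weight changes -/

/-- The space `L²([0,1], H)`. -/
abbrev L2Time (H : Type*) [NormedAddCommGroup H] : Type _ :=
  Lp H 2 (volume.restrict (Icc (0 : ℝ) 1))

/-- The Hilbert space `V` of vector fields is continuously embedded in `C₀²(ℝⁿ, ℝⁿ)`, the `C²`
vector fields that vanish at infinity with their first and second derivatives. -/
def EmbedsC20 {n : ℕ} (V : Type*) [NormedAddCommGroup V] [InnerProductSpace ℝ V]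
    [RKHS ℝ V (Eucl n) (Eucl n)] : Prop :=
  (∀ u : V, ContDiff ℝ 2 (u : Eucl n → Eucl n) ∧ ∀ j : ℕ, j ≤ 2 →
    Tendsto (fun x => iteratedFDeriv ℝ j (u : Eucl n → Eucl n) x) (cocompact (Eucl n)) (𝓝 0)) ∧
  ∃ c : ℝ, ∀ u : V, ∀ j : ℕ, j ≤ 2 → ∀ x : Eucl n,
    ‖iteratedFDeriv ℝ j (u : Eucl n → Eucl n) x‖ ≤ c * ‖u‖

/-- `φ` is a flow of `v` on `[0,1]`: `φ_t(x) = x + ∫₀ᵗ v_s(φ_s(x)) ds`. -/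
def IsFlow {n : ℕ} {V : Type*} [NormedAddCommGroup V] [InnerProductSpace ℝ V]
    [RKHS ℝ V (Eucl n) (Eucl n)] (v : ℝ → V) (φ : ℝ → Eucl n → Eucl n) : Prop :=
  ∀ x, ContinuousOn (fun t => φ t x) (Icc 0 1) ∧
    ∀ t ∈ Icc (0 : ℝ) 1, φ t x = x + ∫ s in (0 : ℝ)..t, v s (φ s x)

open Classical in
/-- The flow map `φ^v` of `v`, which exists and is unique on `[0,1]` when `v` is in `L²([0,1], V)`
and `V` is embedded in `C₀²` (by convention the identity if there is none). -/
def flowMap {n : ℕ} {V : Type*} [NormedAddCommGroup V] [InnerProductSpace ℝ V]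
    [RKHS ℝ V (Eucl n) (Eucl n)] (v : ℝ → V) : ℝ → Eucl n → Eucl n :=
  if h : ∃ φ, IsFlow v φ then h.choose else fun _ x => x

/-- `α̃_t = 1 + ½ ∫₀ᵗ η_s ds`, the integral being taken in `L²(ρ)`. -/
def alphaTilde {n : ℕ} {ρ : Measure (Eucl n)} (η : L2Time (Lp ℝ 2 ρ)) (t : ℝ) (x : Eucl n) : ℝ :=
  1 + (1 / 2) * (∫ s in (0 : ℝ)..t, η s : Lp ℝ 2 ρ) x

/-- The transformed varifold `μ_t = ((α̃_t)² ∘ (φ_t^v)⁻¹) (φ_t^v)_# μ`. -/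
def transported {n d : ℕ} {V : Type*} [NormedAddCommGroup V] [InnerProductSpace ℝ V]
    [RKHS ℝ V (Eucl n) (Eucl n)] (μ : Measure (VSpace n d)) (v : L2Time V)
    (η : L2Time (Lp ℝ 2 (weight μ))) (t : ℝ) : Measure (VSpace n d) :=
  metaAction (flowMap (v : ℝ → V) t) (fun x => alphaTilde η t x ^ 2) μ

/-! ### Kernel metrics -/

open Classical in
/-- The function `(x, u) ↦ ω(x, span u)` on the open subset `ℝⁿ × {frames}` of `ℝⁿ × (ℝⁿ)ᵈ`, extended
by `0`. -/
def frameLift {n d : ℕ} (ω : VSpace n d → ℝ) (p : Eucl n × (Fin d → Eucl n)) : ℝ :=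
  if h : LinearIndependent ℝ p.2 then ω (p.1, OGrass.span ⟨p.2, h⟩) else 0

/-- `W` is continuously embedded in `C₀¹(ℝⁿ × G̃)`: its elements are `C¹`, vanish at infinity with
their differential, and their `C¹` sup-norm is bounded by a constant times their norm in `W`.

Since `u ↦ span u` is a submersion from the frames onto `G̃`, being `C¹` is read on the lift to
frames. The lift is constant along the fibres, whose tangent space at an orthonormal frame `u`
is orthogonal to the horizontal space `{h | h_i ⟂ span u}`, the tangent space of `G̃` with its
metric; so, up to the choice of equivalent norms on `(ℝⁿ)ᵈ`, the derivative of the lift at `(x, u)`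
has the norm of the differential of `ω` at `(x, span u)`. -/
def EmbedsC10 {n d : ℕ} (W : Type*) [NormedAddCommGroup W] [InnerProductSpace ℝ W]
    [RKHS ℝ W (VSpace n d) ℝ] : Prop :=
  (∀ ω : W,
    ContDiffOn ℝ 1 (frameLift (ω : VSpace n d → ℝ)) {p | LinearIndependent ℝ p.2} ∧
    ∀ ε : ℝ, 0 < ε → ∃ M : ℝ, ∀ x : Eucl n, M < ‖x‖ →
      (∀ U : OGrass n d, |ω (x, U)| < ε) ∧
      ∀ u : Fin d → Eucl n, Orthonormal ℝ u →
        ‖fderiv ℝ (frameLift (ω : VSpace n d → ℝ)) (x, u)‖ < ε) ∧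
  ∃ c : ℝ, ∀ ω : W, ∀ x : Eucl n,
    (∀ U : OGrass n d, |ω (x, U)| ≤ c * ‖ω‖) ∧
    ∀ u : Fin d → Eucl n, Orthonormal ℝ u →
      ‖fderiv ℝ (frameLift (ω : VSpace n d → ℝ)) (x, u)‖ ≤ c * ‖ω‖

/-- The dual distance `‖μ' - μ‖_{W*} = sup {(μ' - μ | ω) : ‖ω‖_W ≤ 1}`. -/
def dualDist {n d : ℕ} (W : Type*) [NormedAddCommGroup W] [InnerProductSpace ℝ W]
    [RKHS ℝ W (VSpace n d) ℝ] (μ μ' : Measure (VSpace n d)) : ℝ :=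
  ⨆ ω : {ω : W // ‖ω‖ ≤ 1}, ((∫ z, ω.1 z ∂μ') - ∫ z, ω.1 z ∂μ)

/-- The relaxed LDDMM-Fisher-Rao functional. -/
def relaxedCost {n d : ℕ} {V : Type*} [NormedAddCommGroup V] [InnerProductSpace ℝ V]
    [RKHS ℝ V (Eucl n) (Eucl n)] (W : Type*) [NormedAddCommGroup W] [InnerProductSpace ℝ W]
    [RKHS ℝ W (VSpace n d) ℝ] (γ lam : ℝ) (μ μtar : Measure (VSpace n d))
    (v : L2Time V) (η : L2Time (Lp ℝ 2 (weight μ))) : ℝ :=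
  1 / 2 * (∫ t in (0 : ℝ)..1, ‖v t‖ ^ 2) +
  γ / 2 * (∫ t in (0 : ℝ)..1, ∫ p,
    (η t : Eucl n → ℝ) p.1 ^ 2 *
      OGrass.jac (fderiv ℝ (flowMap (v : ℝ → V) t) p.1) p.2 ∂μ) +
  lam / 2 * dualDist W (transported μ v η 1) μtar ^ 2

end

noncomputable section

/-! ### Square integrable functions of time -/

/-! Fix `v`. Only the values of `η` at the atoms of the weight matter. At a position `a`, let `J t`
be the total transported mass of the atoms of `μ` sitting there, before the weight change. The final
varifold sees `η` only through the square of `β = alphaTilde η 1 a`, and `∫ η = 2 (β - 1)`. By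
completing a square (`sq_integral_div_le`), the least energy for a given `β` is `2 γ (β - 1)² / ∫
J⁻¹`, reached when `η J` is constant in time. Passing from `β` to `|β|` keeps `β²` and does not
increase `(β - 1)²`; for `β ≥ 0` the optimal path runs through convex combinations of `1` and `β`,
so it stays nonnegative. The problem thus becomes the minimization of `reducedCost` over `v` and
finitely many nonnegative numbers.

The direct method applies to `reducedCost`. Bounded cost bounds `‖v‖`, so a minimizing sequence has
a weak limit. The crux is that, at a fixed point, the flow and its differential are continuous in
`v` for the weak topology, uniformly in time (`L2Time.tendstoUniformlyOn_of_integral_eq`). Both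
solve integral equations whose integrand is a continuous path of operators applied to the control.
For a fixed path of operators, weak convergence gives pointwise convergence, and Hölder-1/2
equicontinuity makes it uniform; Grönwall absorbs the change of operators.

The differential of the flow is injective, so `J > 0` and `∫ J⁻¹` passes to the limit; this also
bounds the numbers `β`. The final varifolds are finite sums of Dirac masses that converge against
each `ω`, so the dual distance, a supremum of such pairings, is lower semicontinuous, as is `‖v‖²`.
-/

theorem sq_integral_mul_le {X : Type*} [MeasurableSpace X] {ν : Measure X} {f g : X → ℝ}
    (hf : MemLp f 2 ν) (hg : MemLp g 2 ν) :
    (∫ x, f x * g x ∂ν) ^ 2 ≤ (∫ x, f x ^ 2 ∂ν) * ∫ x, g x ^ 2 ∂ν := by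
  have hfg : Integrable (fun x => f x * g x) ν := hf.integrable_mul hg
  -- The polynomial is `∫ (f + r g)²`, so its discriminant is nonpositive.
  have key : ∀ r : ℝ, 0 ≤ (∫ x, g x ^ 2 ∂ν) * (r * r) + (2 * ∫ x, f x * g x ∂ν) * r +
      ∫ x, f x ^ 2 ∂ν := by
    intro r
    have h0 : 0 ≤ ∫ x, (f x + r * g x) ^ 2 ∂ν := integral_nonneg fun x => sq_nonneg _
    have h1 : ∫ x, (f x + r * g x) ^ 2 ∂ν =
        ∫ x, (f x ^ 2 + (2 * r) * (f x * g x)) + r ^ 2 * g x ^ 2 ∂ν := by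
      congr 1; ext x; ring
    have h2 : Integrable (fun x => f x ^ 2 + (2 * r) * (f x * g x)) ν :=
      hf.integrable_sq.add (hfg.const_mul _)
    rw [h1, integral_add h2 (hg.integrable_sq.const_mul _), integral_add hf.integrable_sq (hfg.const_mul _),
      integral_const_mul, integral_const_mul] at h0
    linarith
  have := discrim_le_zero key
  rw [discrim] at this
  linarith

section L2Time

variable {H : Type*} [NormedAddCommGroup H]

theorem L2Time.memLp (v : L2Time H) : MemLp (fun s => ‖v s‖) 2 (volume.restrict (Icc (0 : ℝ) 1)) :=
  (Lp.memLp v).norm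

theorem L2Time.integrableOn_norm (v : L2Time H) : IntegrableOn (fun s => ‖v s‖) (Icc (0 : ℝ) 1) :=
  (L2Time.memLp v).integrable one_le_two

theorem intervalIntegrable_of_mem_unit {F : Type*} [NormedAddCommGroup F] {f : ℝ → F}
    (hf : IntegrableOn f (Icc (0 : ℝ) 1)) {s t : ℝ} (hs : s ∈ Icc (0 : ℝ) 1)
    (ht : t ∈ Icc (0 : ℝ) 1) : IntervalIntegrable f volume s t :=
  (hf.mono_set (uIcc_subset_Icc hs ht)).intervalIntegrable

theorem L2Time.intervalIntegrable_norm_mul (v : L2Time H) {f : ℝ → ℝ}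
    (hf : ContinuousOn f (Icc 0 1)) {s t : ℝ}
    (hs : s ∈ Icc (0 : ℝ) 1) (ht : t ∈ Icc (0 : ℝ) 1) :
    IntervalIntegrable (fun s => ‖v s‖ * f s) volume s t :=
  intervalIntegrable_of_mem_unit ((L2Time.integrableOn_norm v).mul_continuousOn hf isCompact_Icc)
    hs ht

theorem L2Time.integral_sq_norm [InnerProductSpace ℝ H] (v : L2Time H) :
    ∫ s in (0 : ℝ)..1, ‖v s‖ ^ 2 = ‖v‖ ^ 2 := by
  rw [← real_inner_self_eq_norm_sq, L2.inner_def, intervalIntegral.integral_of_le zero_le_one,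
    ← integral_Icc_eq_integral_Ioc]
  simp

theorem L2Time.sq_integral_norm_mul_le [InnerProductSpace ℝ H] (v : L2Time H) {f : ℝ → ℝ}
    (hf : ContinuousOn f (Icc 0 1)) {s t : ℝ} (hs : 0 ≤ s) (hst : s ≤ t) (ht : t ≤ 1) :
    (∫ r in s..t, ‖v r‖ * f r) ^ 2 ≤ ‖v‖ ^ 2 * ∫ r in s..t, f r ^ 2 := by
  have hsub : Ioc s t ⊆ Icc 0 1 := fun r hr => ⟨hs.trans hr.1.le, hr.2.trans ht⟩
  have hle : volume.restrict (Ioc s t) ≤ volume.restrict (Icc (0 : ℝ) 1) :=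
    Measure.restrict_mono hsub le_rfl
  obtain ⟨B, hB⟩ := isCompact_Icc.exists_bound_of_continuousOn hf
  have hf2 : MemLp f 2 (volume.restrict (Icc (0 : ℝ) 1)) :=
    MemLp.of_bound (hf.aestronglyMeasurable measurableSet_Icc) B
      ((ae_restrict_iff' measurableSet_Icc).2 (ae_of_all _ hB))
  rw [intervalIntegral.integral_of_le hst, intervalIntegral.integral_of_le hst]
  refine (sq_integral_mul_le ((L2Time.memLp v).mono_measure hle) (hf2.mono_measure hle)).trans ?_
  refine mul_le_mul_of_nonneg_right ?_ (integral_nonneg fun _ => sq_nonneg _)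
  rw [← L2Time.integral_sq_norm, intervalIntegral.integral_of_le zero_le_one,
    ← integral_Icc_eq_integral_Ioc (x := 0)]
  exact integral_mono_measure hle (ae_of_all _ fun _ => sq_nonneg _) (L2Time.memLp v).integrable_sq

theorem L2Time.integral_norm_le [InnerProductSpace ℝ H] (v : L2Time H) {s t : ℝ} (hs : 0 ≤ s)
    (hst : s ≤ t) (ht : t ≤ 1) : ∫ r in s..t, ‖v r‖ ≤ ‖v‖ * √(t - s) := by
  have h := L2Time.sq_integral_norm_mul_le v (f := fun _ => 1) continuousOn_const hs hst ht
  simp only [mul_one, one_pow, intervalIntegral.integral_const, smul_eq_mul] at h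
  refine (le_abs_self _).trans (abs_le_of_sq_le_sq ?_ (by positivity))
  rwa [mul_pow, Real.sq_sqrt (sub_nonneg.2 hst)]

end L2Time

/-! ### Grönwall inequalities -/

theorem le_mul_exp_of_le_add_integral {g : ℝ → ℝ} {T A B : ℝ} (hg : ContinuousOn g (Icc 0 T))
    (hg0 : ∀ t ∈ Icc 0 T, 0 ≤ g t) (hA : 0 ≤ A) (hB : 0 ≤ B)
    (h : ∀ t ∈ Icc 0 T, g t ≤ A + B * ∫ s in (0 : ℝ)..t, g s) :
    ∀ t ∈ Icc 0 T, g t ≤ A * Real.exp (B * t) := by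
  intro t ht
  have hT : 0 ≤ T := ht.1.trans ht.2
  -- A continuous extension beyond `[0, T]` has a primitive that is differentiable at the endpoints
  -- too.
  set f : ℝ → ℝ := IccExtend hT ((Icc 0 T).domRestrict g) with hf
  have hfc : Continuous f := hg.domRestrict.Icc_extend'
  have hfg : ∀ s ∈ Icc 0 T, f s = g s := fun s hs => by
    rw [hf, IccExtend_of_mem hT _ hs, domRestrict_apply]
  have hf0 : ∀ s, 0 ≤ f s := fun s => by
    simp only [hf, IccExtend, Function.comp, domRestrict_apply]; exact hg0 _ (projIcc 0 T hT s).2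
  set G : ℝ → ℝ := fun t => A + B * ∫ s in (0 : ℝ)..t, f s with hG
  have hGd : ∀ s, HasDerivAt G (B * f s) s := fun s => 
    ((hfc.integral_hasStrictDerivAt 0 s).hasDerivAt.const_mul B).const_add A
  have hint : ∀ s ∈ Icc 0 T, ∫ r in (0 : ℝ)..s, f r = ∫ r in (0 : ℝ)..s, g r := fun s hs =>
    intervalIntegral.integral_congr fun r hr => by
      rw [uIcc_of_le hs.1] at hr
      exact hfg r ⟨hr.1, hr.2.trans hs.2⟩
  have hGf : ∀ s ∈ Icc 0 T, f s ≤ G s := fun s hs => by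
    rw [hfg s hs, hG]; simp only [hint s hs]; exact h s hs
  have hG0 : ∀ s ∈ Icc 0 T, 0 ≤ G s := fun s hs => (hf0 s).trans (hGf s hs)
  have := norm_le_gronwallBound_of_norm_deriv_right_le (f := G) (f' := fun s => B * f s)
    (δ := A) (K := B) (ε := 0) (a := 0) (b := T)
    (fun s _ => (hGd s).continuousAt.continuousWithinAt) (fun s _ => (hGd s).hasDerivWithinAt)
    (by simp [hG, abs_of_nonneg hA]) (fun s hs => by
      have hs' := Ico_subset_Icc_self hs
      rw [Real.norm_of_nonneg (mul_nonneg hB (hf0 s)), Real.norm_of_nonneg (hG0 s hs'), add_zero]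
      exact mul_le_mul_of_nonneg_left (hGf s hs') hB) t ht
  rw [gronwallBound_ε0, sub_zero, Real.norm_of_nonneg (hG0 t ht)] at this
  exact (hfg t ht).symm.le.trans ((hGf t ht).trans this)

/-- Grönwall's inequality with a square integrable rate. -/
theorem L2Time.gronwall {H : Type*} [NormedAddCommGroup H] [InnerProductSpace ℝ H] (v : L2Time H)
    {f : ℝ → ℝ} (hf : ContinuousOn f (Icc 0 1)) (hf0 : ∀ t ∈ Icc (0 : ℝ) 1, 0 ≤ f t) {a K : ℝ}
    (ha : 0 ≤ a)
    (h : ∀ t ∈ Icc (0 : ℝ) 1, f t ≤ a + K * ∫ s in (0 : ℝ)..t, ‖v s‖ * f s) :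
    ∀ t ∈ Icc (0 : ℝ) 1, f t ≤ a * (2 * Real.exp ((K * ‖v‖) ^ 2)) := by
  intro t ht
  -- The rate is only square integrable, so Grönwall is applied to `f²`: Cauchy–Schwarz and `(a +
  -- b)² ≤ 2 a² + 2 b²` give it the constant rate `2 (K ‖v‖)²`.
  have h2 : f t ^ 2 ≤ 2 * a ^ 2 * Real.exp (2 * (K * ‖v‖) ^ 2 * t) := by
    refine le_mul_exp_of_le_add_integral (g := fun s => f s ^ 2) (hf.pow 2)
      (fun _ _ => sq_nonneg _) (by positivity) (by positivity) (fun s hs => ?_) t ht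
    have h1 := L2Time.sq_integral_norm_mul_le v hf le_rfl hs.1 hs.2
    have h3 := pow_le_pow_left₀ (hf0 s hs) (h s hs) 2
    have h4 := mul_le_mul_of_nonneg_left h1 (sq_nonneg K)
    nlinarith [sq_nonneg (a - K * ∫ r in (0 : ℝ)..s, ‖v r‖ * f r)]
  refine (le_abs_self _).trans (abs_le_of_sq_le_sq (h2.trans ?_) (by positivity))
  have h5 : Real.exp (2 * (K * ‖v‖) ^ 2 * t) ≤ Real.exp ((K * ‖v‖) ^ 2) ^ 2 := by
    rw [← Real.exp_nat_mul]
    refine Real.exp_le_exp.2 ?_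
    have : 2 * (K * ‖v‖) ^ 2 * t ≤ 2 * (K * ‖v‖) ^ 2 * 1 :=
      mul_le_mul_of_nonneg_left ht.2 (by positivity)
    push_cast; linarith
  have h6 := mul_le_mul_of_nonneg_left h5 (sq_nonneg a)
  have h7 : 0 ≤ a ^ 2 * Real.exp ((K * ‖v‖) ^ 2) ^ 2 := by positivity
  nlinarith

/-! ### Differential equations controlled by a square integrable path -/

section Control

variable {V E : Type*} [NormedAddCommGroup V] [InnerProductSpace ℝ V]
  [NormedAddCommGroup E] [NormedSpace ℝ E] {P : ℝ → V →L[ℝ] E}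

theorem L2Time.integrableOn_apply (v : L2Time V) (hP : ContinuousOn P (Icc 0 1)) :
    IntegrableOn (fun s => P s (v s)) (Icc (0 : ℝ) 1) := by
  obtain ⟨B, hB⟩ := isCompact_Icc.exists_bound_of_continuousOn hP
  refine Integrable.mono' ((L2Time.integrableOn_norm v).const_mul B) ?_ ?_
  · exact (ContinuousLinearMap.id ℝ (V →L[ℝ] E)).aestronglyMeasurable_comp₂
      (hP.aestronglyMeasurable measurableSet_Icc) (Lp.aestronglyMeasurable v)
  · exact (ae_restrict_iff' measurableSet_Icc).2 (ae_of_all _ fun s hs =>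
      ((P s).le_opNorm _).trans (mul_le_mul_of_nonneg_right (hB s hs) (norm_nonneg _)))

theorem L2Time.intervalIntegrable_apply (v : L2Time V) (hP : ContinuousOn P (Icc 0 1)) {s t : ℝ}
    (hs : s ∈ Icc (0 : ℝ) 1) (ht : t ∈ Icc (0 : ℝ) 1) :
    IntervalIntegrable (fun s => P s (v s)) volume s t :=
  intervalIntegrable_of_mem_unit (L2Time.integrableOn_apply v hP) hs ht

theorem L2Time.norm_integral_apply_le (v : L2Time V) {B : ℝ}
    (hB : ∀ s ∈ Icc (0 : ℝ) 1, ‖P s‖ ≤ B) {s t : ℝ} (hs : 0 ≤ s) (hst : s ≤ t) (ht : t ≤ 1) :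
    ‖∫ r in s..t, P r (v r)‖ ≤ B * (‖v‖ * √(t - s)) := by
  have hB0 : 0 ≤ B := (norm_nonneg _).trans (hB s ⟨hs, hst.trans ht⟩)
  have h1 := intervalIntegral.norm_integral_le_of_norm_le (f := fun r => P r (v r))
    (g := fun r => B * ‖v r‖) (μ := volume) hst
    (ae_of_all _ fun r hr => ((P r).le_opNorm _).trans
      (mul_le_mul_of_nonneg_right (hB r ⟨hs.trans hr.1.le, hr.2.trans ht⟩) (norm_nonneg _)))
    ((intervalIntegrable_of_mem_unit (L2Time.integrableOn_norm v) ⟨hs, hst.trans ht⟩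
      ⟨hs.trans hst, ht⟩).const_mul B)
  rw [intervalIntegral.integral_const_mul] at h1
  exact h1.trans (mul_le_mul_of_nonneg_left (L2Time.integral_norm_le v hs hst ht) hB0)

theorem L2Time.continuousOn_integral_apply (v : L2Time V) (hP : ContinuousOn P (Icc 0 1)) :
    ContinuousOn (fun t => ∫ s in (0 : ℝ)..t, P s (v s)) (Icc 0 1) := by
  have := intervalIntegral.continuousOn_primitive_interval (μ := volume) (a := 0) (b := 1)
    (f := fun s => P s (v s))
  rw [uIcc_of_le zero_le_one] at this
  exact this (L2Time.integrableOn_apply v hP)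

/-- Weak convergence of controls can be tested on these integrals because the bound `B * √t` makes
them continuous linear in the control. -/
theorem L2Time.exists_clm_integral_apply (hP : ContinuousOn P (Icc 0 1)) {t : ℝ}
    (ht : t ∈ Icc (0 : ℝ) 1) :
    ∃ T : L2Time V →L[ℝ] E, ∀ v, T v = ∫ s in (0 : ℝ)..t, P s (v s) := by
  obtain ⟨B, hB⟩ := isCompact_Icc.exists_bound_of_continuousOn hP
  have h0 : (0 : ℝ) ∈ Icc (0 : ℝ) 1 := ⟨le_rfl, zero_le_one⟩
  -- Sums and multiples in `Lp` agree with the pointwise ones only almost everywhere.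
  have hae : ∀ {f g : ℝ → V}, f =ᵐ[volume.restrict (Icc (0 : ℝ) 1)] g →
      ∫ s in (0 : ℝ)..t, P s (f s) = ∫ s in (0 : ℝ)..t, P s (g s) := fun {f g} h => by
    rw [intervalIntegral.integral_of_le ht.1, intervalIntegral.integral_of_le ht.1]
    refine integral_congr_ae ?_
    have := ae_restrict_of_ae_restrict_of_subset
      (fun r hr => ⟨hr.1.le, hr.2.trans ht.2⟩ : Ioc 0 t ⊆ Icc 0 1) h
    filter_upwards [this] with s hs
    rw [hs]
  let T : L2Time V →ₗ[ℝ] E :=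
    { toFun := fun v => ∫ s in (0 : ℝ)..t, P s (v s)
      map_add' := fun v w => by
        rw [hae (Lp.coeFn_add v w)]
        simp only [Pi.add_apply, map_add]
        exact intervalIntegral.integral_add (L2Time.intervalIntegrable_apply v hP h0 ht)
          (L2Time.intervalIntegrable_apply w hP h0 ht)
      map_smul' := fun c v => by
        rw [hae (Lp.coeFn_smul c v)]
        simp }
  refine ⟨T.mkContinuous (B * √(t - 0)) fun v => ?_, fun v => rfl⟩
  exact (L2Time.norm_integral_apply_le v hB le_rfl ht.1 ht.2).trans_eq (by ring)

/-- If `P` is uniformly bounded and `v_i` is bounded and converges weakly to `v`, then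
`∫₀ᵗ P_s v_i(s) ds` converges uniformly in `t`. -/
theorem L2Time.tendstoUniformlyOn_integral_apply [FiniteDimensional ℝ E] {ι : Type*}
    {l : Filter ι} {u : ι → L2Time V} {v : L2Time V} {M : ℝ} (hM : ∀ i, ‖u i‖ ≤ M)
    (huv : ∀ T : L2Time V →L[ℝ] ℝ, Tendsto (fun i => T (u i)) l (𝓝 (T v)))
    (hP : ContinuousOn P (Icc 0 1)) :
    TendstoUniformlyOn (fun i t => ∫ s in (0 : ℝ)..t, P s (u i s))
      (fun t => ∫ s in (0 : ℝ)..t, P s (v s)) l (Icc 0 1) := by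
  have hpt : ∀ t ∈ Icc (0 : ℝ) 1, Tendsto (fun i => ∫ s in (0 : ℝ)..t, P s (u i s)) l
      (𝓝 (∫ s in (0 : ℝ)..t, P s (v s))) := by
    intro t ht
    obtain ⟨T, hT⟩ := L2Time.exists_clm_integral_apply hP ht
    simp only [← hT]
    let e := (Module.finBasis ℝ E).equivFunL
    have h : Tendsto (fun i => e (T (u i))) l (𝓝 (e (T v))) := by
      rw [tendsto_pi_nhds]
      intro j
      exact huv ((ContinuousLinearMap.proj (R := ℝ) (φ := fun _ => ℝ) j).comp
        ((e : E →L[ℝ] (_ → ℝ)).comp T))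
    simpa [Function.comp_def] using (e.symm.continuous.tendsto _).comp h
  obtain ⟨B, hB⟩ := isCompact_Icc.exists_bound_of_continuousOn hP
  have h0 : (0 : ℝ) ∈ Icc (0 : ℝ) 1 := ⟨le_rfl, zero_le_one⟩
  have hB0 : 0 ≤ B := (norm_nonneg _).trans (hB 0 h0)
  set L := B * (max M ‖v‖) with hL
  have hL0 : 0 ≤ L := mul_nonneg hB0 ((norm_nonneg v).trans (le_max_right _ _))
  -- Equicontinuity: by Cauchy–Schwarz all the primitives are Hölder-1/2 with the same constant `L`.
  have hosc : ∀ w : L2Time V, ‖w‖ ≤ max M ‖v‖ → ∀ a b : ℝ, 0 ≤ a → a ≤ b → b ≤ 1 →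
      ‖(∫ s in (0 : ℝ)..b, P s (w s)) - ∫ s in (0 : ℝ)..a, P s (w s)‖ ≤ L * √(b - a) := by
    intro w hw a b ha hab hb
    have ha' : a ∈ Icc (0 : ℝ) 1 := ⟨ha, hab.trans hb⟩
    have hb' : b ∈ Icc (0 : ℝ) 1 := ⟨ha.trans hab, hb⟩
    rw [intervalIntegral.integral_interval_sub_left (L2Time.intervalIntegrable_apply w hP h0 hb')
      (L2Time.intervalIntegrable_apply w hP h0 ha')]
    refine (L2Time.norm_integral_apply_le w hB ha hab hb).trans ?_
    rw [hL, mul_assoc]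
    gcongr
  rw [Metric.tendstoUniformlyOn_iff]
  intro ε hε
  -- On a grid of mesh `1 / k`, each primitive oscillates by less than `ε / 3` between grid points,
  -- so convergence at the finitely many grid points suffices.
  obtain ⟨k, hk⟩ := exists_nat_gt ((3 * L / ε) ^ 2)
  have hk0 : (0 : ℝ) < k := (sq_nonneg _).trans_lt hk
  have hstep : L * √(1 / k) < ε / 3 := by
    have h1 : 3 * L / ε < √k := Real.lt_sqrt_of_sq_lt hk
    rw [Real.sqrt_div zero_le_one, Real.sqrt_one, mul_one_div, div_lt_iff₀ (Real.sqrt_pos.2 hk0)]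
    rw [div_lt_iff₀ hε] at h1
    linarith
  have hev : ∀ᶠ i in l, ∀ j ∈ Finset.range (k + 1),
      dist (∫ s in (0 : ℝ)..(j / k), P s (v s)) (∫ s in (0 : ℝ)..(j / k), P s (u i s)) < ε / 3 := by
    rw [Filter.eventually_all_finset]
    intro j hj
    have hj' : (j : ℝ) ≤ k := by exact_mod_cast Nat.lt_succ_iff.1 (Finset.mem_range.1 hj)
    have := (hpt (j / k) ⟨by positivity, (div_le_one hk0).2 hj'⟩).eventually
      (Metric.ball_mem_nhds _ (by positivity : 0 < ε / 3))
    filter_upwards [this] with i hi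
    rw [dist_comm]; exact hi
  filter_upwards [hev] with i hi t ht
  set j := ⌊t * k⌋₊ with hj
  have hj1 : (j : ℝ) ≤ t * k := Nat.floor_le (mul_nonneg ht.1 hk0.le)
  have hj2 : t * k < j + 1 := Nat.lt_floor_add_one _
  have hjk : (j : ℝ) ≤ k := hj1.trans (mul_le_of_le_one_left hk0.le ht.2)
  have hjm : j ∈ Finset.range (k + 1) := by
    rw [Finset.mem_range, Nat.lt_succ_iff]; exact_mod_cast hjk
  have hle : (j : ℝ) / k ≤ t := (div_le_iff₀ hk0).2 hj1
  have hd : t - j / k ≤ 1 / k := by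
    rw [sub_le_iff_le_add, ← add_div, le_div_iff₀ hk0]; linarith
  have hs : L * √(t - j / k) < ε / 3 :=
    (mul_le_mul_of_nonneg_left (Real.sqrt_le_sqrt hd) hL0).trans_lt hstep
  have h1 := hosc v (le_max_right _ _) (j / k) t (by positivity) hle ht.2
  have h2 := hosc (u i) ((hM i).trans (le_max_left _ _)) (j / k) t (by positivity) hle ht.2
  have h3 := hi j hjm
  rw [← dist_eq_norm] at h1 h2
  rw [dist_comm] at h2
  linarith [dist_triangle4 (∫ s in (0 : ℝ)..t, P s (v s)) (∫ s in (0 : ℝ)..(j / k), P s (v s))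
    (∫ s in (0 : ℝ)..(j / k), P s (u i s)) (∫ s in (0 : ℝ)..t, P s (u i s))]

/-- The solutions of controlled equations depend continuously on the control for its weak
topology. -/
theorem L2Time.tendstoUniformlyOn_of_integral_eq [FiniteDimensional ℝ E] {ι : Type*}
    {l : Filter ι} {u : ι → L2Time V} {v : L2Time V} {M : ℝ} (hM : ∀ i, ‖u i‖ ≤ M)
    (huv : ∀ T : L2Time V →L[ℝ] ℝ, Tendsto (fun i => T (u i)) l (𝓝 (T v)))
    (hP : ContinuousOn P (Icc 0 1)) {Q : ι → ℝ → V →L[ℝ] E}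
    (hQ : ∀ i, ContinuousOn (Q i) (Icc 0 1)) {y : ℝ → E} {z : ι → ℝ → E} {x : E}
    (hyc : ContinuousOn y (Icc 0 1)) (hzc : ∀ i, ContinuousOn (z i) (Icc 0 1))
    (hy : ∀ t ∈ Icc (0 : ℝ) 1, y t = x + ∫ s in (0 : ℝ)..t, P s (v s))
    (hz : ∀ i, ∀ t ∈ Icc (0 : ℝ) 1, z i t = x + ∫ s in (0 : ℝ)..t, Q i s (u i s))
    {c : ℝ} (hc : 0 ≤ c) (hPQ : ∀ δ > 0, ∀ᶠ i in l, ∀ s ∈ Icc (0 : ℝ) 1,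
      ‖Q i s - P s‖ ≤ c * ‖z i s - y s‖ + δ) :
    TendstoUniformlyOn z y l (Icc 0 1) := by
  rw [Metric.tendstoUniformlyOn_iff]
  intro ε hε
  rcases isEmpty_or_nonempty ι with hι | ⟨⟨i₀⟩⟩
  · exact Eventually.of_forall fun i => (hι.false i).elim
  have hM0 : 0 ≤ M := (norm_nonneg _).trans (hM i₀)
  set C := 2 * Real.exp ((c * M) ^ 2) with hC
  have hC0 : 0 < C := by positivity
  -- The total error will be `δ + δ * M`, which Grönwall multiplies by at most `C`; the result is `ε
  -- / 2`.
  set δ := ε / (2 * C * (M + 1)) with hδ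
  have hδ0 : 0 < δ := by positivity
  have hconv := Metric.tendstoUniformlyOn_iff.1
    (L2Time.tendstoUniformlyOn_integral_apply hM huv hP) δ hδ0
  filter_upwards [hconv, hPQ δ hδ0] with i hi hi' t ht
  have h0 : (0 : ℝ) ∈ Icc (0 : ℝ) 1 := ⟨le_rfl, zero_le_one⟩
  have hfc : ContinuousOn (fun s => ‖z i s - y s‖) (Icc 0 1) := ((hzc i).sub hyc).norm
  have main : ∀ t ∈ Icc (0 : ℝ) 1, ‖z i t - y t‖ ≤
      δ * (M + 1) + c * ∫ s in (0 : ℝ)..t, ‖u i s‖ * ‖z i s - y s‖ := by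
    intro t ht
    -- The first difference has the fixed operators `P` and tends to `0` by weak convergence; the
    -- last integral is left to Grönwall.
    have e1 : z i t - y t = ((∫ s in (0 : ℝ)..t, P s (u i s)) - ∫ s in (0 : ℝ)..t, P s (v s)) +
        ∫ s in (0 : ℝ)..t, (Q i s - P s) (u i s) := by
      simp only [sub_apply]
      rw [hz i t ht, hy t ht, intervalIntegral.integral_sub
        (L2Time.intervalIntegrable_apply _ (hQ i) h0 ht)
        (L2Time.intervalIntegrable_apply _ hP h0 ht)]
      abel
    have e2 : ‖∫ s in (0 : ℝ)..t, (Q i s - P s) (u i s)‖ ≤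
        ∫ s in (0 : ℝ)..t, (c * (‖u i s‖ * ‖z i s - y s‖) + δ * ‖u i s‖) := by
      refine intervalIntegral.norm_integral_le_of_norm_le ht.1 (ae_of_all _ fun s hs => ?_) ?_
      · refine ((Q i s - P s).le_opNorm _).trans ?_
        refine (mul_le_mul_of_nonneg_right (hi' s ⟨hs.1.le, hs.2.trans ht.2⟩)
          (norm_nonneg _)).trans_eq ?_
        ring
      · exact ((L2Time.intervalIntegrable_norm_mul _ hfc h0 ht).const_mul c).add
          ((intervalIntegrable_of_mem_unit (L2Time.integrableOn_norm _) h0 ht).const_mul δ)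
    rw [intervalIntegral.integral_add
      ((L2Time.intervalIntegrable_norm_mul _ hfc h0 ht).const_mul c)
      ((intervalIntegrable_of_mem_unit (L2Time.integrableOn_norm _) h0 ht).const_mul δ),
      intervalIntegral.integral_const_mul, intervalIntegral.integral_const_mul] at e2
    have e3 : ∫ s in (0 : ℝ)..t, ‖u i s‖ ≤ M := by
      refine (L2Time.integral_norm_le (u i) le_rfl ht.1 ht.2).trans ?_
      have : √(t - 0) ≤ 1 := Real.sqrt_le_one.2 (by linarith [ht.2])
      calc ‖u i‖ * √(t - 0) ≤ M * 1 := mul_le_mul (hM i) this (Real.sqrt_nonneg _) hM0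
        _ = M := mul_one M
    have e4 := hi t ht
    rw [dist_comm, dist_eq_norm] at e4
    rw [e1]
    refine (norm_add_le _ _).trans ?_
    have e5 := mul_le_mul_of_nonneg_left e3 hδ0.le
    calc _ ≤ _ := add_le_add e4.le e2
      _ ≤ _ := by linarith
  have hfin := L2Time.gronwall (u i) hfc (fun _ _ => norm_nonneg _) (by positivity) main t ht
  rw [dist_comm, dist_eq_norm]
  have hexp : 2 * Real.exp ((c * ‖u i‖) ^ 2) ≤ C := by
    rw [hC]
    have := hM i
    gcongr
  calc ‖z i t - y t‖ ≤ δ * (M + 1) * C :=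
        hfin.trans (mul_le_mul_of_nonneg_left hexp (by positivity))
    _ = ε / 2 := by rw [hδ]; field_simp
    _ < ε := by linarith

end Control

/-! ### Backward uniqueness and Picard iteration for controlled equations. -/

section Control

variable {V E : Type*} [NormedAddCommGroup V] [InnerProductSpace ℝ V]
  [NormedAddCommGroup E] [NormedSpace ℝ E]

theorem L2Time.sq_norm_integral_apply_le (v : L2Time V) {P : ℝ → V →L[ℝ] E} {f : ℝ → ℝ} {c : ℝ}
    (hf : ContinuousOn f (Icc 0 1))
    (hPf : ∀ s ∈ Icc (0 : ℝ) 1, ‖P s‖ ≤ c * f s) {s t : ℝ} (hs : 0 ≤ s) (hst : s ≤ t)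
    (ht : t ≤ 1) :
    ‖∫ r in s..t, P r (v r)‖ ^ 2 ≤ (c * ‖v‖) ^ 2 * ∫ r in s..t, f r ^ 2 := by
  have h1 : ‖∫ r in s..t, P r (v r)‖ ≤ ∫ r in s..t, c * (‖v r‖ * f r) := by
    refine intervalIntegral.norm_integral_le_of_norm_le hst (ae_of_all _ fun r hr => ?_)
      ((L2Time.intervalIntegrable_norm_mul v hf ⟨hs, hst.trans ht⟩ ⟨hs.trans hst, ht⟩).const_mul c)
    refine ((P r).le_opNorm _).trans ((mul_le_mul_of_nonneg_right
      (hPf r ⟨hs.trans hr.1.le, hr.2.trans ht⟩) (norm_nonneg _)).trans_eq (by ring))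
  rw [intervalIntegral.integral_const_mul] at h1
  calc ‖∫ r in s..t, P r (v r)‖ ^ 2 ≤ (c * ∫ r in s..t, ‖v r‖ * f r) ^ 2 :=
        pow_le_pow_left₀ (norm_nonneg _) h1 2
    _ = c ^ 2 * (∫ r in s..t, ‖v r‖ * f r) ^ 2 := by ring
    _ ≤ c ^ 2 * (‖v‖ ^ 2 * ∫ r in s..t, f r ^ 2) :=
        mul_le_mul_of_nonneg_left (L2Time.sq_integral_norm_mul_le v hf hs hst ht) (sq_nonneg _)
    _ = _ := by ring

/-- A solution of a linear controlled equation that vanishes at some time vanishes at time `0`. -/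
theorem L2Time.eq_zero_of_integral_eq (v : L2Time V) {P : ℝ → V →L[ℝ] E}
    (hP : ContinuousOn P (Icc 0 1)) {h : ℝ → E} (hh : ContinuousOn h (Icc 0 1)) {x : E} {c : ℝ}
    (hPh : ∀ s ∈ Icc (0 : ℝ) 1, ‖P s‖ ≤ c * ‖h s‖)
    (heq : ∀ t ∈ Icc (0 : ℝ) 1, h t = x + ∫ s in (0 : ℝ)..t, P s (v s)) {t : ℝ}
    (ht : t ∈ Icc (0 : ℝ) 1) (h0 : h t = 0) : x = 0 := by
  have hz : (0 : ℝ) ∈ Icc (0 : ℝ) 1 := ⟨le_rfl, zero_le_one⟩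
  -- Since `h t = 0`, the value `h s` is minus the integral from `s` to `t`; Grönwall is then run
  -- backwards from `t` with initial value `0`.
  have key : ∀ s ∈ Icc 0 t, ‖h s‖ ^ 2 ≤ (c * ‖v‖) ^ 2 * ∫ r in s..t, ‖h r‖ ^ 2 := by
    intro s hs
    have hs1 : s ∈ Icc (0 : ℝ) 1 := ⟨hs.1, hs.2.trans ht.2⟩
    have e : h s = - ∫ r in s..t, P r (v r) := by
      rw [← intervalIntegral.integral_interval_sub_left
        (L2Time.intervalIntegrable_apply v hP hz ht) (L2Time.intervalIntegrable_apply v hP hz hs1)]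
      have e1 := heq t ht
      rw [h0] at e1
      rw [heq s hs1, eq_neg_of_add_eq_zero_left e1.symm]
      abel
    rw [e, norm_neg]
    exact L2Time.sq_norm_integral_apply_le v hh.norm hPh hs.1 hs.2 ht.2
  have hmap : MapsTo (fun s => t - s) (Icc 0 t) (Icc 0 1) := fun s hs =>
    ⟨sub_nonneg.2 hs.2, by linarith [hs.1, ht.2]⟩
  have hg : ContinuousOn (fun s => ‖h (t - s)‖ ^ 2) (Icc 0 t) :=
    ((hh.comp (by fun_prop) hmap).norm.pow 2)
  have := le_mul_exp_of_le_add_integral (A := 0) (B := (c * ‖v‖) ^ 2) hg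
    (fun _ _ => sq_nonneg _) le_rfl (sq_nonneg _) (fun s hs => by
      have h2 := key (t - s) ⟨sub_nonneg.2 hs.2, by linarith [hs.1]⟩
      rw [intervalIntegral.integral_comp_sub_left (fun r => ‖h r‖ ^ 2) t]
      simpa using h2) t ⟨ht.1, le_rfl⟩
  have h3 : h 0 = 0 := by
    rw [sub_self, zero_mul] at this
    exact norm_eq_zero.1 (pow_eq_zero_iff two_ne_zero |>.1 (le_antisymm this (sq_nonneg _)))
  have h4 := heq 0 hz
  rw [h3, intervalIntegral.integral_same, add_zero] at h4
  exact h4.symm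

/-- Existence of solutions of controlled equations with Lipschitz coefficients. -/
theorem L2Time.exists_integral_eq [CompleteSpace E] (v : L2Time V) {G : ℝ → E → V →L[ℝ] E}
    (hG : ∀ y : ℝ → E, ContinuousOn y (Icc 0 1) → ContinuousOn (fun s => G s (y s)) (Icc 0 1))
    {c : ℝ} (hGc : ∀ s ∈ Icc (0 : ℝ) 1, ∀ z z', ‖G s z - G s z'‖ ≤ c * ‖z - z'‖) (x : E) :
    ∃ y : ℝ → E, ContinuousOn y (Icc 0 1) ∧
      ∀ t ∈ Icc (0 : ℝ) 1, y t = x + ∫ s in (0 : ℝ)..t, G s (y s) (v s) := by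
  have hz : (0 : ℝ) ∈ Icc (0 : ℝ) 1 := ⟨le_rfl, zero_le_one⟩
  let ext : C(Icc (0 : ℝ) 1, E) → ℝ → E := fun y => IccExtend zero_le_one y
  have hext : ∀ y, ContinuousOn (ext y) (Icc 0 1) := fun y =>
    (y.continuous.Icc_extend').continuousOn
  have hint : ∀ y, ContinuousOn (fun t => x + ∫ s in (0 : ℝ)..t, G s (ext y s) (v s)) (Icc 0 1) :=
    fun y => continuousOn_const.add (L2Time.continuousOn_integral_apply v (hG _ (hext y)))
  let Φ : C(Icc (0 : ℝ) 1, E) → C(Icc (0 : ℝ) 1, E) := fun y => ⟨_, (hint y).domRestrict⟩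
  have hΦ : ∀ y, ∀ t (ht : t ∈ Icc (0 : ℝ) 1),
      ext (Φ y) t = x + ∫ s in (0 : ℝ)..t, G s (ext y s) (v s) := fun y t ht => by
    simp only [ext, Φ, IccExtend_of_mem _ _ ht]
    rfl
  set K := (c * ‖v‖) ^ 2 with hK
  -- Picard estimates for squared distances, since Cauchy–Schwarz with a square integrable rate
  -- controls squares.
  have hiter : ∀ (m : ℕ) (y z : C(Icc (0 : ℝ) 1, E)), ∀ t ∈ Icc (0 : ℝ) 1,
      ‖ext (Φ^[m] y) t - ext (Φ^[m] z) t‖ ^ 2 ≤ K ^ m * t ^ m / m.factorial * dist y z ^ 2 := by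
    intro m y z
    induction m with
    | zero =>
      intro t ht
      simp only [Function.iterate_zero, id_eq, pow_zero, Nat.factorial_zero, Nat.cast_one, div_one,
        one_mul, mul_one]
      refine pow_le_pow_left₀ (norm_nonneg _) ?_ 2
      rw [← dist_eq_norm]
      exact ContinuousMap.dist_apply_le_dist _
    | succ m ih =>
      intro t ht
      rw [Function.iterate_succ_apply', Function.iterate_succ_apply', hΦ _ t ht, hΦ _ t ht,
        add_sub_add_left_eq_sub, ← intervalIntegral.integral_sub
        (L2Time.intervalIntegrable_apply v (hG _ (hext _)) hz ht)
        (L2Time.intervalIntegrable_apply v (hG _ (hext _)) hz ht)]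
      have h1 := L2Time.sq_norm_integral_apply_le v
        (P := fun s => G s (ext (Φ^[m] y) s) - G s (ext (Φ^[m] z) s)) (c := c)
        (f := fun s => ‖ext (Φ^[m] y) s - ext (Φ^[m] z) s‖)
        ((hext _).sub (hext _)).norm (fun s hs => hGc s hs _ _) le_rfl ht.1 ht.2
      simp only [sub_apply] at h1
      refine h1.trans ?_
      have h2 : ∫ s in (0 : ℝ)..t, ‖ext (Φ^[m] y) s - ext (Φ^[m] z) s‖ ^ 2 ≤
          ∫ s in (0 : ℝ)..t, K ^ m * s ^ m / m.factorial * dist y z ^ 2 := by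
        refine intervalIntegral.integral_mono_on ht.1 ?_ ?_ fun s hs =>
          ih s ⟨hs.1, hs.2.trans ht.2⟩
        · refine ContinuousOn.intervalIntegrable ?_
          refine (((hext _).sub (hext _)).norm.pow 2).mono ?_
          exact uIcc_subset_Icc hz ht
        · exact Continuous.intervalIntegrable (by fun_prop) _ _
      have h3 : ∫ s in (0 : ℝ)..t, K ^ m * s ^ m / m.factorial * dist y z ^ 2 =
          K ^ m / m.factorial * dist y z ^ 2 * (t ^ (m + 1) / (m + 1)) := by
        have : ∀ s : ℝ, K ^ m * s ^ m / m.factorial * dist y z ^ 2 =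
          K ^ m / m.factorial * dist y z ^ 2 * s ^ m := fun s => by ring
        simp only [this]
        rw [intervalIntegral.integral_const_mul, integral_pow]
        simp
      rw [h3] at h2
      refine (mul_le_mul_of_nonneg_left h2 (sq_nonneg _)).trans_eq ?_
      rw [← hK, Nat.factorial_succ]
      push_cast
      field_simp
      ring
  -- A factor `1 / 4` on squared distances makes the `m`-th iterate a contraction of ratio `1 / 2`;
  -- its fixed point is also fixed by `Φ`.
  obtain ⟨m, hm⟩ := ((FloorSemiring.tendsto_pow_div_factorial_atTop K).eventually
    (gt_mem_nhds (by norm_num : (0 : ℝ) < 1 / 4))).exists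
  have hcontr : ContractingWith (1 / 2) Φ^[m] := by
    refine ⟨by norm_num, LipschitzWith.of_dist_le_mul fun y z => ?_⟩
    refine (ContinuousMap.dist_le (by positivity)).2 fun t => ?_
    have h1 := hiter m y z t t.2
    simp only [ext, IccExtend_val] at h1
    rw [dist_eq_norm]
    refine (le_abs_self _).trans (abs_le_of_sq_le_sq (h1.trans ?_) (by positivity))
    have h2 : (t : ℝ) ^ m ≤ 1 := pow_le_one₀ t.2.1 t.2.2
    have h3 : K ^ m * (t : ℝ) ^ m / m.factorial ≤ 1 / 4 := by
      refine le_trans ?_ hm.le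
      have : 0 ≤ K ^ m := pow_nonneg (sq_nonneg _) m
      gcongr
      exact mul_le_of_le_one_right this h2
    refine (mul_le_mul_of_nonneg_right h3 (sq_nonneg _)).trans_eq ?_
    rw [mul_pow]
    norm_num
  have hfix := hcontr.isFixedPt_fixedPoint_iterate
  set y := ContractingWith.fixedPoint Φ^[m] hcontr
  refine ⟨ext y, hext y, fun t ht => ?_⟩
  rw [← hΦ y t ht, hfix.eq]

end Control

/-! ### Flows -/

section Flow

variable {n : ℕ} {V : Type*} [NormedAddCommGroup V] [InnerProductSpace ℝ V]
  [RKHS ℝ V (Eucl n) (Eucl n)]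

/-- The vector fields of `V` are twice differentiable, with `C²` bounds `c * ‖u‖`. -/
structure HasC2Bound (V : Type*) [NormedAddCommGroup V] [InnerProductSpace ℝ V]
    [RKHS ℝ V (Eucl n) (Eucl n)] (c : ℝ) : Prop where
  nonneg : 0 ≤ c
  differentiable : ∀ u : V, Differentiable ℝ (u : Eucl n → Eucl n)
  norm_le : ∀ (u : V) (x : Eucl n), ‖u x‖ ≤ c * ‖u‖
  norm_fderiv_le : ∀ (u : V) (x : Eucl n), ‖fderiv ℝ (u : Eucl n → Eucl n) x‖ ≤ c * ‖u‖
  norm_fderiv_sub_le : ∀ (u : V) (x y : Eucl n),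
    ‖fderiv ℝ (u : Eucl n → Eucl n) x - fderiv ℝ (u : Eucl n → Eucl n) y‖ ≤ c * ‖u‖ * ‖x - y‖

/-- These bounds are all that the proof needs from the embedding of `V`; decay at infinity plays no
role. The mean value inequality turns the bound on second derivatives into a Lipschitz bound. -/
theorem EmbedsC20.exists_hasC2Bound (hV : EmbedsC20 (n := n) V) :
    ∃ c, HasC2Bound (n := n) V c := by
  obtain ⟨h1, c, hc⟩ := hV
  have hle : ∀ u : V, c * ‖u‖ ≤ max c 0 * ‖u‖ := fun u =>
    mul_le_mul_of_nonneg_right (le_max_left _ _) (norm_nonneg _)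
  have hdiff : ∀ u : V, Differentiable ℝ (u : Eucl n → Eucl n) := fun u =>
    (h1 u).1.differentiable (by norm_num)
  refine ⟨max c 0, le_max_right _ _, hdiff, fun u x => ?_, fun u x => ?_, fun u x y => ?_⟩
  · have := hc u 0 (by norm_num) x
    rw [norm_iteratedFDeriv_zero] at this
    exact this.trans (hle u)
  · have := hc u 1 (by norm_num) x
    rw [norm_iteratedFDeriv_one] at this
    exact this.trans (hle u)
  · have hd : Differentiable ℝ (fderiv ℝ (u : Eucl n → Eucl n)) :=
      ((h1 u).1.fderiv_right (m := 1) (by norm_num)).differentiable (by norm_num)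
    refine convex_univ.norm_image_sub_le_of_norm_fderiv_le (𝕜 := ℝ) (fun z _ => hd z) (fun z _ => ?_)
      (mem_univ y) (mem_univ x)
    have := hc u 2 le_rfl z
    rw [← norm_iteratedFDeriv_fderiv, norm_iteratedFDeriv_one] at this
    exact this.trans (hle u)

namespace HasC2Bound

variable {c : ℝ} (hb : HasC2Bound (n := n) V c)

/-- Evaluation at a point. -/
def eval (_ : HasC2Bound (n := n) V c) (x : Eucl n) : V →L[ℝ] Eucl n :=
  (ContinuousLinearMap.proj (R := ℝ) (φ := fun _ : Eucl n => Eucl n) x).comp (RKHS.coeCLM ℝ)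

@[simp]
theorem eval_apply (x : Eucl n) (u : V) : hb.eval x u = u x := rfl

/-- Evaluation of the differential at a point. -/
def deriv (x : Eucl n) : V →L[ℝ] Eucl n →L[ℝ] Eucl n :=
  LinearMap.mkContinuous
    { toFun := fun u => fderiv ℝ (u : Eucl n → Eucl n) x
      map_add' := fun u w => by
        rw [RKHS.coe_add]
        exact fderiv_add (hb.differentiable u x) (hb.differentiable w x)
      map_smul' := fun r u => by
        rw [RKHS.coe_smul]
        exact fderiv_const_smul (hb.differentiable u x) r } c fun u => hb.norm_fderiv_le u x

include hb in
theorem norm_sub_le (u : V) (x y : Eucl n) : ‖u x - u y‖ ≤ c * ‖u‖ * ‖x - y‖ :=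
  convex_univ.norm_image_sub_le_of_norm_fderiv_le (𝕜 := ℝ) (fun z _ => hb.differentiable u z)
    (fun z _ => hb.norm_fderiv_le u z) (mem_univ y) (mem_univ x)

include hb in
theorem norm_sub_sub_le (u : V) (x y : Eucl n) :
    ‖u y - u x - fderiv ℝ (u : Eucl n → Eucl n) x (y - x)‖ ≤ c * ‖u‖ * ‖y - x‖ ^ 2 := by
  have h := (convex_segment x y).norm_image_sub_le_of_norm_fderiv_le' (𝕜 := ℝ)
    (f := (u : Eucl n → Eucl n)) (φ := fderiv ℝ (u : Eucl n → Eucl n) x)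
    (C := c * ‖u‖ * ‖y - x‖) (fun z _ => hb.differentiable u z) (fun z hz => ?_)
    (left_mem_segment ℝ x y) (right_mem_segment ℝ x y)
  · exact h.trans_eq (by ring)
  · refine (hb.norm_fderiv_sub_le u z x).trans ?_
    exact mul_le_mul_of_nonneg_left (norm_sub_le_of_mem_segment hz)
      (mul_nonneg hb.nonneg (norm_nonneg _))

/-- This makes `eval` continuous in operator norm, so that along a continuous path the flow equation
has the form of a controlled equation. -/
theorem norm_eval_sub_le (x y : Eucl n) : ‖hb.eval x - hb.eval y‖ ≤ c * ‖x - y‖ :=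
  ContinuousLinearMap.opNorm_le_bound _ (mul_nonneg hb.nonneg (norm_nonneg _)) fun u =>
    (hb.norm_sub_le u x y).trans_eq (by ring)

theorem norm_deriv_sub_le (x y : Eucl n) : ‖hb.deriv x - hb.deriv y‖ ≤ c * ‖x - y‖ :=
  ContinuousLinearMap.opNorm_le_bound _ (mul_nonneg hb.nonneg (norm_nonneg _)) fun u =>
    (hb.norm_fderiv_sub_le u x y).trans_eq (by ring)

theorem continuous_eval : Continuous hb.eval :=
  (LipschitzWith.of_dist_le_mul (K := ⟨c, hb.nonneg⟩) fun x y => by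
    rw [dist_eq_norm, dist_eq_norm]; exact hb.norm_eval_sub_le x y).continuous

theorem continuous_deriv : Continuous hb.deriv := by
  have : LipschitzWith ⟨c, hb.nonneg⟩ hb.deriv := LipschitzWith.of_dist_le_mul fun x y => by
    rw [dist_eq_norm, dist_eq_norm]; exact hb.norm_deriv_sub_le x y
  exact this.continuous

/-- The right-hand side `u ↦ d_x u ∘ A` of the equation of the differential of a flow. -/
def linearized (x : Eucl n) (A : Eucl n →L[ℝ] Eucl n) : V →L[ℝ] Eucl n →L[ℝ] Eucl n :=
  ((ContinuousLinearMap.compL ℝ (Eucl n) (Eucl n) (Eucl n)).flip A).comp (hb.deriv x)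

@[simp]
theorem linearized_apply (x : Eucl n) (A : Eucl n →L[ℝ] Eucl n) (u : V) :
    hb.linearized x A u = (fderiv ℝ (u : Eucl n → Eucl n) x).comp A := rfl

theorem norm_linearized_sub_le (x : Eucl n) (A B : Eucl n →L[ℝ] Eucl n) :
    ‖hb.linearized x A - hb.linearized x B‖ ≤ c * ‖A - B‖ := by
  refine ContinuousLinearMap.opNorm_le_bound _ (mul_nonneg hb.nonneg (norm_nonneg _)) fun u => ?_
  rw [sub_apply, linearized_apply, linearized_apply, ← ContinuousLinearMap.comp_sub]
  refine (ContinuousLinearMap.opNorm_comp_le _ _).trans ?_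
  refine (mul_le_mul_of_nonneg_right (hb.norm_fderiv_le u x) (norm_nonneg _)).trans_eq (by ring)

theorem norm_linearized_sub_le' (x y : Eucl n) (A : Eucl n →L[ℝ] Eucl n) :
    ‖hb.linearized x A - hb.linearized y A‖ ≤ c * ‖x - y‖ * ‖A‖ := by
  refine ContinuousLinearMap.opNorm_le_bound _
    (mul_nonneg (mul_nonneg hb.nonneg (norm_nonneg _)) (norm_nonneg _)) fun u => ?_
  rw [sub_apply, linearized_apply, linearized_apply, ← ContinuousLinearMap.sub_comp]
  refine (ContinuousLinearMap.opNorm_comp_le _ _).trans ?_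
  refine (mul_le_mul_of_nonneg_right (hb.norm_fderiv_sub_le u x y) (norm_nonneg _)).trans_eq
    (by ring)

theorem continuousOn_linearized {y : ℝ → Eucl n} {A : ℝ → Eucl n →L[ℝ] Eucl n} {s : Set ℝ}
    (hy : ContinuousOn y s) (hA : ContinuousOn A s) :
    ContinuousOn (fun t => hb.linearized (y t) (A t)) s := by
  have h1 : ContinuousOn (fun t => hb.deriv (y t)) s := hb.continuous_deriv.comp_continuousOn hy
  exact (((ContinuousLinearMap.compL ℝ (Eucl n) (Eucl n)
    (Eucl n)).flip.continuous.comp_continuousOn hA)).clm_comp h1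

/-! ### Existence, regularity and differential of the flow. -/

include hb in
theorem exists_isFlow (v : L2Time V) : ∃ φ, IsFlow (n := n) (v : ℝ → V) φ := by
  have h := fun x => L2Time.exists_integral_eq v (G := fun _ z => hb.eval z) (c := c)
    (fun y hy => hb.continuous_eval.comp_continuousOn hy)
    (fun _ _ z z' => hb.norm_eval_sub_le z z') x
  choose y hy using h
  exact ⟨fun t x => y x t, fun x => ⟨(hy x).1, (hy x).2⟩⟩

include hb in
theorem isFlow_flowMap (v : L2Time V) : IsFlow (n := n) (v : ℝ → V) (flowMap (v : ℝ → V)) := by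
  rw [flowMap, dif_pos (hb.exists_isFlow v)]
  exact (hb.exists_isFlow v).choose_spec

include hb in
theorem continuousOn_flowMap (v : L2Time V) (x : Eucl n) :
    ContinuousOn (fun t => flowMap (v : ℝ → V) t x) (Icc 0 1) :=
  (hb.isFlow_flowMap v x).1

theorem flowMap_eq (v : L2Time V) (x : Eucl n) {t : ℝ} (ht : t ∈ Icc (0 : ℝ) 1) :
    flowMap (v : ℝ → V) t x = x + ∫ s in (0 : ℝ)..t, hb.eval (flowMap (v : ℝ → V) s x) (v s) :=
  (hb.isFlow_flowMap v x).2 t ht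

theorem continuousOn_eval_flowMap (v : L2Time V) (x : Eucl n) :
    ContinuousOn (fun t => hb.eval (flowMap (v : ℝ → V) t x)) (Icc 0 1) :=
  hb.continuous_eval.comp_continuousOn (hb.continuousOn_flowMap v x)

include hb in
theorem norm_flowMap_sub_le (v : L2Time V) (x y : Eucl n) {t : ℝ} (ht : t ∈ Icc (0 : ℝ) 1) :
    ‖flowMap (v : ℝ → V) t x - flowMap (v : ℝ → V) t y‖ ≤
      ‖x - y‖ * (2 * Real.exp ((c * ‖v‖) ^ 2)) := by
  have h0 : (0 : ℝ) ∈ Icc (0 : ℝ) 1 := ⟨le_rfl, zero_le_one⟩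
  have hcont := ((hb.continuousOn_flowMap v x).sub (hb.continuousOn_flowMap v y)).norm
  refine L2Time.gronwall v hcont (fun _ _ => norm_nonneg _) (norm_nonneg _) (fun t ht => ?_) t ht
  have e : flowMap (v : ℝ → V) t x - flowMap (v : ℝ → V) t y = (x - y) +
      ∫ s in (0 : ℝ)..t, (v s (flowMap (v : ℝ → V) s x) - v s (flowMap (v : ℝ → V) s y)) := by
    rw [hb.flowMap_eq v x ht, hb.flowMap_eq v y ht]
    have := intervalIntegral.integral_sub
      (L2Time.intervalIntegrable_apply v (hb.continuousOn_eval_flowMap v x) h0 ht)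
      (L2Time.intervalIntegrable_apply v (hb.continuousOn_eval_flowMap v y) h0 ht)
    simp only [eval_apply] at this ⊢
    rw [this]
    abel
  rw [Pi.sub_apply, e]
  refine (norm_add_le _ _).trans (add_le_add_right ?_ _)
  rw [← intervalIntegral.integral_const_mul]
  refine intervalIntegral.norm_integral_le_of_norm_le ht.1 (ae_of_all _ fun s _ => ?_)
    ((L2Time.intervalIntegrable_norm_mul v hcont h0 ht).const_mul c)
  exact (hb.norm_sub_le _ _ _).trans_eq (by simp only [Pi.sub_apply]; ring)

/-- The candidate `A` solves the linearized equation. The remainder of the first-order expansion in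
`h` solves the same equation up to a source of order `‖h‖²`, so Grönwall makes it `O(‖h‖²)`. -/
theorem exists_differential_flowMap (v : L2Time V) (x : Eucl n) :
    ∃ A : ℝ → Eucl n →L[ℝ] Eucl n, ContinuousOn A (Icc 0 1) ∧
      (∀ t ∈ Icc (0 : ℝ) 1, A t = ContinuousLinearMap.id ℝ (Eucl n) +
        ∫ s in (0 : ℝ)..t, hb.linearized (flowMap (v : ℝ → V) s x) (A s) (v s)) ∧
      ∀ t ∈ Icc (0 : ℝ) 1, HasFDerivAt (flowMap (v : ℝ → V) t) (A t) x := by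
  have h0 : (0 : ℝ) ∈ Icc (0 : ℝ) 1 := ⟨le_rfl, zero_le_one⟩
  obtain ⟨A, hAc, hA⟩ := L2Time.exists_integral_eq v
    (G := fun s A => hb.linearized (flowMap (v : ℝ → V) s x) A) (c := c)
    (fun y hy => hb.continuousOn_linearized (hb.continuousOn_flowMap v x) hy)
    (fun _ _ z z' => hb.norm_linearized_sub_le _ z z') (ContinuousLinearMap.id ℝ (Eucl n))
  refine ⟨A, hAc, hA, fun t ht => ?_⟩
  set C := 2 * Real.exp ((c * ‖v‖) ^ 2) with hC
  have hC0 : 0 ≤ C := by positivity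
  have hbound : ∀ h : Eucl n, ‖flowMap (v : ℝ → V) t (x + h) - flowMap (v : ℝ → V) t x - A t h‖ ≤
      c * ‖v‖ * C ^ 2 * C * ‖h‖ ^ 2 := by
    intro h
    set R : ℝ → Eucl n := fun t =>
      flowMap (v : ℝ → V) t (x + h) - flowMap (v : ℝ → V) t x - A t h with hR
    have hL := hb.continuousOn_linearized (hb.continuousOn_flowMap v x) hAc
    have hRc : ContinuousOn (fun s => ‖R s‖) (Icc 0 1) :=
      (((hb.continuousOn_flowMap v _).sub (hb.continuousOn_flowMap v _)).sub
        (hAc.clm_apply continuousOn_const)).norm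
    have key : ∀ t ∈ Icc (0 : ℝ) 1, ‖R t‖ ≤
        c * ‖v‖ * C ^ 2 * ‖h‖ ^ 2 + c * ∫ s in (0 : ℝ)..t, ‖v s‖ * ‖R s‖ := by
      intro t ht
      have i1 := L2Time.intervalIntegrable_apply v (hb.continuousOn_eval_flowMap v (x + h)) h0 ht
      have i2 := L2Time.intervalIntegrable_apply v (hb.continuousOn_eval_flowMap v x) h0 ht
      have i3 := L2Time.intervalIntegrable_apply v hL h0 ht
      have i4 : IntervalIntegrable (fun s => hb.linearized (flowMap (v : ℝ → V) s x) (A s) (v s) h)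
        volume 0 t := 
        ⟨(ContinuousLinearMap.apply ℝ (Eucl n) h).integrable_comp i3.1,
          (ContinuousLinearMap.apply ℝ (Eucl n) h).integrable_comp i3.2⟩
      have e : R t = ∫ s in (0 : ℝ)..t, (hb.eval (flowMap (v : ℝ → V) s (x + h)) (v s) -
          hb.eval (flowMap (v : ℝ → V) s x) (v s) -
          hb.linearized (flowMap (v : ℝ → V) s x) (A s) (v s) h) := by
        rw [intervalIntegral.integral_sub (i1.sub i2) i4, intervalIntegral.integral_sub i1 i2,
          ← ContinuousLinearMap.intervalIntegral_apply i3, hR]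
        simp only
        rw [hb.flowMap_eq v _ ht, hb.flowMap_eq v x ht, hA t ht]
        simp only [add_apply, ContinuousLinearMap.id_apply]
        abel
      have hle : ‖R t‖ ≤ ∫ s in (0 : ℝ)..t,
          (c * (‖v s‖ * ‖R s‖) + c * C ^ 2 * ‖h‖ ^ 2 * ‖v s‖) := by
        rw [e]
        refine intervalIntegral.norm_integral_le_of_norm_le ht.1 (ae_of_all _ fun s hs => ?_) ?_
        · have hs' : s ∈ Icc (0 : ℝ) 1 := ⟨hs.1.le, hs.2.trans ht.2⟩
          -- A Taylor remainder of `v s`, quadratic in the displacement and hence in `h`, plus the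
          -- differential of `v s` applied to the remainder `R s`.
          have e2 : hb.eval (flowMap (v : ℝ → V) s (x + h)) (v s) -
              hb.eval (flowMap (v : ℝ → V) s x) (v s) -
              hb.linearized (flowMap (v : ℝ → V) s x) (A s) (v s) h =
              (v s (flowMap (v : ℝ → V) s (x + h)) - v s (flowMap (v : ℝ → V) s x) -
                fderiv ℝ (v s : Eucl n → Eucl n) (flowMap (v : ℝ → V) s x)
                  (flowMap (v : ℝ → V) s (x + h) - flowMap (v : ℝ → V) s x)) +
              fderiv ℝ (v s : Eucl n → Eucl n) (flowMap (v : ℝ → V) s x) (R s) := by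
            simp only [hR, eval_apply, linearized_apply, ContinuousLinearMap.comp_apply, map_sub]
            abel
          rw [e2]
          have b1 := hb.norm_sub_sub_le (v s) (flowMap (v : ℝ → V) s x)
            (flowMap (v : ℝ → V) s (x + h))
          have b2 := (fderiv ℝ (v s : Eucl n → Eucl n)
            (flowMap (v : ℝ → V) s x)).le_of_opNorm_le (hb.norm_fderiv_le (v s) _) (R s)
          have b3 := hb.norm_flowMap_sub_le v (x + h) x hs'
          rw [add_sub_cancel_left] at b3
          have b4 := pow_le_pow_left₀ (norm_nonneg _) b3 2
          have b5 := mul_le_mul_of_nonneg_left b4 (mul_nonneg hb.nonneg (norm_nonneg (v s)))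
          refine (norm_add_le _ _).trans ((add_le_add (b1.trans b5) b2).trans_eq ?_)
          rw [hC]; ring
        · exact ((L2Time.intervalIntegrable_norm_mul v hRc h0 ht).const_mul c).add
            ((intervalIntegrable_of_mem_unit (L2Time.integrableOn_norm v) h0 ht).const_mul _)
      rw [intervalIntegral.integral_add
        ((L2Time.intervalIntegrable_norm_mul v hRc h0 ht).const_mul c)
        ((intervalIntegrable_of_mem_unit (L2Time.integrableOn_norm v) h0 ht).const_mul _),
        intervalIntegral.integral_const_mul, intervalIntegral.integral_const_mul] at hle
      have hv : ∫ s in (0 : ℝ)..t, ‖v s‖ ≤ ‖v‖ := by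
        refine (L2Time.integral_norm_le v le_rfl ht.1 ht.2).trans ?_
        exact mul_le_of_le_one_right (norm_nonneg _) (Real.sqrt_le_one.2 (by linarith [ht.2]))
      have := mul_le_mul_of_nonneg_left hv
        (mul_nonneg (mul_nonneg hb.nonneg (sq_nonneg C)) (sq_nonneg ‖h‖))
      linarith
    exact (L2Time.gronwall v hRc (fun _ _ => norm_nonneg _)
      (mul_nonneg (mul_nonneg (mul_nonneg hb.nonneg (norm_nonneg _)) (sq_nonneg _))
      (sq_nonneg _)) key t ht).trans_eq (by rw [hC]; ring)
  rw [hasFDerivAt_iff_isLittleO_nhds_zero]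
  refine Asymptotics.IsBigO.trans_isLittleO (g := fun h : Eucl n => ‖h‖ ^ 2) ?_ ?_
  · exact Asymptotics.IsBigO.of_bound _ (Eventually.of_forall fun h =>
      (hbound h).trans_eq (by rw [Real.norm_of_nonneg (sq_nonneg ‖h‖)]))
  · exact Asymptotics.isLittleO_norm_pow_id one_lt_two

include hb in
theorem continuousOn_fderiv_flowMap (v : L2Time V) (x : Eucl n) :
    ContinuousOn (fun t => fderiv ℝ (flowMap (v : ℝ → V) t) x) (Icc 0 1) := by
  obtain ⟨A, hAc, -, hA⟩ := hb.exists_differential_flowMap v x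
  exact hAc.congr fun t ht => (hA t ht).fderiv

theorem fderiv_flowMap_eq (v : L2Time V) (x : Eucl n) {t : ℝ} (ht : t ∈ Icc (0 : ℝ) 1) :
    fderiv ℝ (flowMap (v : ℝ → V) t) x = ContinuousLinearMap.id ℝ (Eucl n) +
      ∫ s in (0 : ℝ)..t, hb.linearized (flowMap (v : ℝ → V) s x)
        (fderiv ℝ (flowMap (v : ℝ → V) s) x) (v s) := by
  obtain ⟨A, -, hA, hA'⟩ := hb.exists_differential_flowMap v x
  rw [(hA' t ht).fderiv, hA t ht]
  congr 1
  refine intervalIntegral.integral_congr fun s hs => ?_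
  rw [uIcc_of_le ht.1] at hs
  simp only [(hA' s ⟨hs.1, hs.2.trans ht.2⟩).fderiv]

-- For a vector `h` in the kernel at time `t`, the path `s ↦ d_xφ_s h` solves a linear equation and
-- vanishes at `t`; hence its initial value, `h` itself, is zero.
include hb in
theorem injective_fderiv_flowMap (v : L2Time V) (x : Eucl n) {t : ℝ} (ht : t ∈ Icc (0 : ℝ) 1) :
    Function.Injective (fderiv ℝ (flowMap (v : ℝ → V) t) x) := by
  have h0 : (0 : ℝ) ∈ Icc (0 : ℝ) 1 := ⟨le_rfl, zero_le_one⟩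
  rw [injective_iff_map_eq_zero]
  intro h hh
  have hA := hb.continuousOn_fderiv_flowMap v x
  have hd : ContinuousOn (fun s => hb.deriv (flowMap (v : ℝ → V) s x)) (Icc 0 1) :=
    hb.continuous_deriv.comp_continuousOn (hb.continuousOn_flowMap v x)
  have hAh : ContinuousOn (fun s => fderiv ℝ (flowMap (v : ℝ → V) s) x h) (Icc 0 1) :=
    hA.clm_apply continuousOn_const
  refine L2Time.eq_zero_of_integral_eq v (c := c)
    (P := fun s => (ContinuousLinearMap.apply ℝ (Eucl n)
      (fderiv ℝ (flowMap (v : ℝ → V) s) x h)).comp (hb.deriv (flowMap (v : ℝ → V) s x)))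
    (h := fun s => fderiv ℝ (flowMap (v : ℝ → V) s) x h)
    (((ContinuousLinearMap.apply ℝ (Eucl n)).continuous.comp_continuousOn hAh).clm_comp hd)
    hAh (fun s _ => ?_) (fun s hs => ?_) ht hh
  · refine ContinuousLinearMap.opNorm_le_bound _ (mul_nonneg hb.nonneg (norm_nonneg _)) fun u => ?_
    exact ((fderiv ℝ (u : Eucl n → Eucl n) _).le_of_opNorm_le (hb.norm_fderiv_le u _) _).trans_eq
      (by ring)
  · have i3 := L2Time.intervalIntegrable_apply v
      (hb.continuousOn_linearized (hb.continuousOn_flowMap v x) hA) h0 hs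
    have := congrArg (fun B : Eucl n →L[ℝ] Eucl n => B h) (hb.fderiv_flowMap_eq v x hs)
    simp only [add_apply, ContinuousLinearMap.id_apply] at this
    rw [this, ContinuousLinearMap.intervalIntegral_apply i3]
    rfl

/-! ### Continuity of the flow and its differential for the weak topology. -/

include hb in
theorem tendstoUniformlyOn_flowMap {ι : Type*} {l : Filter ι} {u : ι → L2Time V} {v : L2Time V}
    {M : ℝ} (hM : ∀ i, ‖u i‖ ≤ M)
    (huv : ∀ T : L2Time V →L[ℝ] ℝ, Tendsto (fun i => T (u i)) l (𝓝 (T v))) (x : Eucl n) :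
    TendstoUniformlyOn (fun i t => flowMap (u i : ℝ → V) t x)
      (fun t => flowMap (v : ℝ → V) t x) l (Icc 0 1) :=
  L2Time.tendstoUniformlyOn_of_integral_eq hM huv (hb.continuousOn_eval_flowMap v x)
    (fun i => hb.continuousOn_eval_flowMap (u i) x) (hb.continuousOn_flowMap v x)
    (fun i => hb.continuousOn_flowMap (u i) x) (fun _ ht => hb.flowMap_eq v x ht)
    (fun i _ ht => hb.flowMap_eq (u i) x ht) hb.nonneg fun _ hδ => Eventually.of_forall
      fun _ _ _ => (hb.norm_eval_sub_le _ _).trans (le_add_of_nonneg_right hδ.le)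

include hb in
theorem tendstoUniformlyOn_fderiv_flowMap {ι : Type*} {l : Filter ι} {u : ι → L2Time V}
    {v : L2Time V} {M : ℝ} (hM : ∀ i, ‖u i‖ ≤ M)
    (huv : ∀ T : L2Time V →L[ℝ] ℝ, Tendsto (fun i => T (u i)) l (𝓝 (T v))) (x : Eucl n) :
    TendstoUniformlyOn (fun i t => fderiv ℝ (flowMap (u i : ℝ → V) t) x)
      (fun t => fderiv ℝ (flowMap (v : ℝ → V) t) x) l (Icc 0 1) := by
  refine L2Time.tendstoUniformlyOn_of_integral_eq hM huv
    (hb.continuousOn_linearized (hb.continuousOn_flowMap v x) (hb.continuousOn_fderiv_flowMap v x))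
    (fun i => hb.continuousOn_linearized (hb.continuousOn_flowMap (u i) x)
      (hb.continuousOn_fderiv_flowMap (u i) x)) (hb.continuousOn_fderiv_flowMap v x)
    (fun i => hb.continuousOn_fderiv_flowMap (u i) x) (fun _ ht => hb.fderiv_flowMap_eq v x ht)
    (fun i _ ht => hb.fderiv_flowMap_eq (u i) x ht) hb.nonneg fun δ hδ => ?_
  obtain ⟨B, hB⟩ := isCompact_Icc.exists_bound_of_continuousOn (hb.continuousOn_fderiv_flowMap v x)
  have hB0 : 0 ≤ B := (norm_nonneg _).trans (hB 0 ⟨le_rfl, zero_le_one⟩)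
  have hc1 : 0 < c + 1 := by linarith [hb.nonneg]
  have hev := Metric.tendstoUniformlyOn_iff.1 (hb.tendstoUniformlyOn_flowMap hM huv x)
    -- The added ones keep the denominator positive when `c` or `B` vanishes.
    (δ / ((c + 1) * (B + 1))) (by positivity)
  filter_upwards [hev] with i hi s hs
  have h1 := hi s hs
  rw [dist_comm, dist_eq_norm, lt_div_iff₀ (by positivity)] at h1
  -- Changing the differential first gives the Grönwall term; changing the base point at the fixed
  -- limit differential gives an error below `δ`, by convergence of the flows.
  refine (norm_sub_le_norm_sub_add_norm_sub _ (hb.linearized (flowMap (u i : ℝ → V) s x)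
    (fderiv ℝ (flowMap (v : ℝ → V) s) x)) _).trans ?_
  refine add_le_add (hb.norm_linearized_sub_le _ _ _)
    ((hb.norm_linearized_sub_le' _ _ _).trans (le_trans ?_ h1.le))
  have hc := hb.nonneg
  calc _ ≤ (c + 1) * ‖flowMap (u i : ℝ → V) s x - flowMap (v : ℝ → V) s x‖ * (B + 1) := by
        gcongr
        · linarith
        · linarith [hB s hs]
    _ = _ := by ring

end HasC2Bound

end Flow

/-! ### Oriented subspaces -/

namespace OGrass

variable {n d : ℕ}

theorem exists_span (U : OGrass n d) : ∃ u : Frame n d, span u = U := Quotient.exists_rep U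

theorem jac_span (A : Eucl n →L[ℝ] Eucl n) (u : Frame n d) :
    jac A (span u) = √((Matrix.gram ℝ fun i => A (u.1 i)).det / (Matrix.gram ℝ u.1).det) := rfl

theorem linearIndependent_map {A : Eucl n →L[ℝ] Eucl n} (hA : Function.Injective A)
    (u : Frame n d) : LinearIndependent ℝ fun i => A (u.1 i) :=
  u.2.map' (A : Eucl n →ₗ[ℝ] Eucl n) (LinearMap.ker_eq_bot.2 hA)

theorem map_span {A : Eucl n →L[ℝ] Eucl n} (hA : Function.Injective A) (u : Frame n d) :
    map A (span u) = span ⟨fun i => A (u.1 i), linearIndependent_map hA u⟩ := by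
  rw [map, dif_pos hA]; rfl

theorem jac_nonneg (A : Eucl n →L[ℝ] Eucl n) (U : OGrass n d) : 0 ≤ jac A U := by
  obtain ⟨u, rfl⟩ := exists_span U
  exact Real.sqrt_nonneg _

theorem jac_pos {A : Eucl n →L[ℝ] Eucl n} (hA : Function.Injective A) (U : OGrass n d) :
    0 < jac A U := by
  obtain ⟨u, rfl⟩ := exists_span U
  rw [jac_span]
  exact Real.sqrt_pos.2 (div_pos
    (Matrix.posDef_gram_of_linearIndependent (linearIndependent_map hA u)).det_pos
    (Matrix.posDef_gram_of_linearIndependent u.2).det_pos)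

theorem continuous_jac (U : OGrass n d) :
    Continuous fun A : Eucl n →L[ℝ] Eucl n => jac A U := by
  obtain ⟨u, rfl⟩ := exists_span U
  simp only [jac_span]
  refine Real.continuous_sqrt.comp (Continuous.div_const (Continuous.matrix_det ?_) _)
  exact continuous_matrix fun i j => by
    simp only [Matrix.gram_apply]
    fun_prop

/-- The mixed Gram determinant is `det (gram u) * det R`, and `det R` cannot vanish when `w` is
independent. The weak inequality therefore encodes orientation by a closed condition. -/
theorem span_eq_span_iff (u w : Frame n d) : span u = span w ↔
    (∀ j, w.1 j ∈ Submodule.span ℝ (range u.1)) ∧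
      0 ≤ (Matrix.of fun i j => inner ℝ (u.1 i) (w.1 j)).det := by
  have hdet : ∀ R : Matrix (Fin d) (Fin d) ℝ, (∀ j, w.1 j = ∑ i, R i j • u.1 i) →
      (Matrix.of fun i j => inner ℝ (u.1 i) (w.1 j)).det = (Matrix.gram ℝ u.1).det * R.det := by
    intro R hR
    rw [← Matrix.det_mul]
    congr 1
    ext i j
    rw [Matrix.of_apply, Matrix.mul_apply, hR, inner_sum]
    exact Finset.sum_congr rfl fun k _ => by
      rw [inner_smul_right, Matrix.gram_apply, mul_comm]
  have hG := (Matrix.posDef_gram_of_linearIndependent u.2).det_pos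
  constructor
  · intro h
    obtain ⟨R, hR, hw⟩ : ∃ R : Matrix (Fin d) (Fin d) ℝ, 0 < R.det ∧
      ∀ j, w.1 j = ∑ i, R i j • u.1 i := Quotient.exact h
    refine ⟨fun j => ?_, ?_⟩
    · rw [hw]
      exact Submodule.sum_mem _ fun i _ => Submodule.smul_mem _ _
        (Submodule.subset_span (mem_range_self i))
    · rw [hdet R hw]
      exact (mul_pos hG hR).le
  · rintro ⟨h, hpos⟩
    simp only [Submodule.mem_span_range_iff_exists_fun] at h
    choose R hR using h
    have hR' : ∀ j, w.1 j = ∑ i, (Matrix.of fun i j => R j i) i j • u.1 i := fun j =>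
      (hR j).symm
    refine Quotient.sound (s := frameSetoid n d) ⟨Matrix.of fun i j => R j i, ?_, hR'⟩
    rw [hdet _ hR'] at hpos
    refine lt_of_le_of_ne (nonneg_of_mul_nonneg_right hpos hG) fun h0 => ?_
    have hw := (Matrix.posDef_gram_of_linearIndependent w.2).det_pos
    rw [gram_comb u.1 w.1 _ hR', Matrix.det_mul, ← h0, mul_zero] at hw
    exact hw.false

/-- Closed points make singletons measurable, as needed for computing with Dirac masses on `VSpace n
d`. -/
instance : T1Space (OGrass n d) := by
  refine ⟨fun U => ?_⟩
  obtain ⟨u, rfl⟩ := exists_span U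
  have hq : IsQuotientMap (span : Frame n d → OGrass n d) := isQuotientMap_quot_mk
  rw [← hq.isClosed_preimage]
  have : (span : Frame n d → OGrass n d) ⁻¹' {span u} =
      (⋂ j, {w | w.1 j ∈ Submodule.span ℝ (range u.1)}) ∩
        {w | 0 ≤ (Matrix.of fun i j => inner ℝ (u.1 i) (w.1 j)).det} := by
    ext w
    rw [mem_preimage, mem_singleton_iff, eq_comm, span_eq_span_iff]
    simp
  rw [this]
  have hc : ∀ j, Continuous fun w : Frame n d => w.1 j := fun j =>
    (continuous_apply j).comp continuous_subtype_val
  refine (isClosed_iInter fun j =>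
    (Submodule.closed_of_finiteDimensional _).preimage (hc j)).inter ?_
  refine isClosed_le continuous_const (Continuous.matrix_det ?_)
  exact continuous_matrix fun i j => continuous_const.inner (hc j)

end OGrass

/-! ### Discrete varifolds -/

section Dirac

variable {α β ι : Type*} [MeasurableSpace α] [MeasurableSingletonClass α] [MeasurableSpace β]
  [Fintype ι]

/-- No measurability of `f` is needed: against a Dirac mass at a measurable point every function is
almost everywhere constant. -/
theorem map_sum_smul_dirac (f : α → β) (c : ι → ENNReal) (z : ι → α) :
    (∑ i, c i • Measure.dirac (z i)).map f = ∑ i, c i • Measure.dirac (f (z i)) := by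
  have hf : AEMeasurable f (∑ i, c i • Measure.dirac (z i)) := by
    rw [← Measure.sum_fintype]
    exact AEMeasurable.sum_measure fun i => aemeasurable_dirac.smul_measure _
  ext s hs
  rw [Measure.map_apply_of_aemeasurable hf hs]
  simp [Measure.finsetSum_apply, Measure.dirac_apply' _ hs, Measure.dirac_apply, indicator]
  rfl

theorem withDensity_sum_smul_dirac (f : α → ENNReal) (c : ι → ENNReal) (z : ι → α) :
    (∑ i, c i • Measure.dirac (z i)).withDensity f =
      ∑ i, (c i * f (z i)) • Measure.dirac (z i) := by
  have h : ∀ a, (Measure.dirac a).withDensity f = f a • Measure.dirac a := fun a => by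
    ext s hs
    rw [withDensity_apply _ hs, ← lintegral_indicator hs, lintegral_dirac]
    by_cases ha : a ∈ s <;> simp [ha, Measure.dirac_apply]
  rw [← Measure.sum_fintype, withDensity_sum, Measure.sum_fintype]
  simp only [withDensity_smul_measure, h, smul_smul]

end Dirac

section DiscreteVarifold

variable {n d N : ℕ} {r : Fin N → ℝ} (x : Fin N → Eucl n) (U : Fin N → OGrass n d)

theorem integral_discreteVarifold (hr : ∀ i, 0 ≤ r i) (f : VSpace n d → ℝ) :
    ∫ z, f z ∂discreteVarifold r x U = ∑ i, r i * f (x i, U i) := by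
  rw [discreteVarifold, integral_finsetSum_measure fun i _ =>
    (integrable_dirac (by simp)).smul_measure ENNReal.ofReal_ne_top]
  refine Finset.sum_congr rfl fun i _ => ?_
  rw [integral_smul_measure, integral_dirac, ENNReal.toReal_ofReal (hr i), smul_eq_mul]

theorem weight_discreteVarifold :
    weight (discreteVarifold r x U) = ∑ i, ENNReal.ofReal (r i) • Measure.dirac (x i) :=
  map_sum_smul_dirac _ _ _

theorem metaAction_discreteVarifold (hr : ∀ i, 0 ≤ r i) (φ : Eucl n → Eucl n) (α : Eucl n → ℝ)
    (hα : ∀ y, 0 ≤ α y) :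
    metaAction φ α (discreteVarifold r x U) = discreteVarifold
      (fun i => r i * α (x i) * OGrass.jac (fderiv ℝ φ (x i)) (U i)) (fun i => φ (x i))
      fun i => OGrass.map (fderiv ℝ φ (x i)) (U i) := by
  rw [metaAction, varifoldPush, rescale, discreteVarifold, withDensity_sum_smul_dirac,
    withDensity_sum_smul_dirac, map_sum_smul_dirac]
  refine Finset.sum_congr rfl fun i _ => ?_
  rw [ENNReal.ofReal_mul (mul_nonneg (hr i) (hα _)), ENNReal.ofReal_mul (hr i)]

instance isFiniteMeasure_discreteVarifold : IsFiniteMeasure (discreteVarifold r x U) := by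
  refine ⟨?_⟩
  rw [discreteVarifold, Measure.finsetSum_apply]
  simp

end DiscreteVarifold

/-! ### Convergence along filters -/

/-- Bounded families in a Hilbert space converge weakly along ultrafilters. -/
theorem Ultrafilter.exists_weak_limit {ι H : Type*} [NormedAddCommGroup H] [InnerProductSpace ℝ H]
    [CompleteSpace H] (l : Ultrafilter ι) {u : ι → H} {M : ℝ} (hM : ∀ i, ‖u i‖ ≤ M) :
    ∃ v : H, ∀ T : H →L[ℝ] ℝ, Tendsto (fun i => T (u i)) l (𝓝 (T v)) := by
  -- Bounded real values converge along an ultrafilter by compactness. The limits depend linearly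
  -- and boundedly on `w`, and Riesz represents them.
  have hlim : ∀ w : H, ∃ a : ℝ, ‖a‖ ≤ M * ‖w‖ ∧ Tendsto (fun i => inner ℝ (u i) w) l (𝓝 a) := by
    intro w
    obtain ⟨a, ha, hal⟩ := (isCompact_closedBall (0 : ℝ) (M * ‖w‖)).ultrafilter_le_nhds'
      (l.map fun i => inner ℝ (u i) w) (Ultrafilter.mem_map.2 (Filter.univ_mem' fun i => by
        rw [mem_preimage, mem_closedBall_zero_iff]
        exact (norm_inner_le_norm _ _).trans
          (mul_le_mul_of_nonneg_right (hM i) (norm_nonneg _))))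
    exact ⟨a, mem_closedBall_zero_iff.1 ha, hal⟩
  choose f hf hfl using hlim
  let L : H →ₗ[ℝ] ℝ :=
    { toFun := f
      map_add' := fun w w' => tendsto_nhds_unique (hfl (w + w')) (by
        simp only [inner_add_right]
        exact (hfl w).add (hfl w'))
      map_smul' := fun c w => tendsto_nhds_unique (hfl (c • w)) (by
        simp only [inner_smul_right]
        exact (hfl w).const_mul c) }
  let v := (InnerProductSpace.toDual ℝ H).symm (L.mkContinuous M hf)
  refine ⟨v, fun T => ?_⟩
  have h1 : ∀ w, inner ℝ w ((InnerProductSpace.toDual ℝ H).symm T) = T w := fun w => by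
    rw [real_inner_comm, InnerProductSpace.toDual_symm_apply]
  have h2 : T v = f ((InnerProductSpace.toDual ℝ H).symm T) := by
    rw [← h1 v, InnerProductSpace.toDual_symm_apply]
    rfl
  simp only [h2, ← h1 (u _)]
  exact hfl _

/-- On a compact set uniform convergence is a local matter, so continuity of `g` at the limit values
is enough. This allows `g` to be an inverse that is singular elsewhere. -/
theorem TendstoUniformlyOn.comp_continuousAt_of_isCompact {ι α β γ : Type*} [TopologicalSpace α]
    [UniformSpace β] [UniformSpace γ] {F : ι → α → β} {f : α → β} {l : Filter ι} {K : Set α}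
    {g : β → γ} (h : TendstoUniformlyOn F f l K) (hK : IsCompact K) (hf : ContinuousOn f K)
    (hg : ∀ x ∈ K, ContinuousAt g (f x)) :
    TendstoUniformlyOn (fun i x => g (F i x)) (fun x => g (f x)) l K := by
  rw [← tendstoLocallyUniformlyOn_iff_tendstoUniformlyOn_of_compact hK,
    tendstoLocallyUniformlyOn_iff_forall_tendsto] at h ⊢
  intro x hx
  have h1 : Tendsto (fun y : ι × α => f y.2) (l ×ˢ 𝓝[K] x) (𝓝 (f x)) := 
    (hf x hx).tendsto.comp tendsto_snd
  have h2 : Tendsto (fun y : ι × α => F y.1 y.2) (l ×ˢ 𝓝[K] x) (𝓝 (f x)) :=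
    Uniform.tendsto_congr (h x hx) |>.1 h1
  exact (((hg x hx).tendsto.comp h1).prodMk_nhds ((hg x hx).tendsto.comp h2)).mono_right
    
    (nhds_le_uniformity _)

theorem TendstoUniformlyOn.tendsto_integral_unit {ι : Type*} {l : Filter ι} {F : ι → ℝ → ℝ}
    {f : ℝ → ℝ} (h : TendstoUniformlyOn F f l (Icc 0 1)) (hF : ∀ i, ContinuousOn (F i) (Icc 0 1))
    (hf : ContinuousOn f (Icc 0 1)) :
    Tendsto (fun i => ∫ t in (0 : ℝ)..1, F i t) l (𝓝 (∫ t in (0 : ℝ)..1, f t)) := by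
  rw [← uIcc_of_le (zero_le_one (α := ℝ))] at hf hF
  rw [Metric.tendsto_nhds]
  intro ε hε
  filter_upwards [Metric.tendstoUniformlyOn_iff.1 h (ε / 2) (by positivity)] with i hi
  rw [dist_eq_norm, ← intervalIntegral.integral_sub (hF i).intervalIntegrable
    hf.intervalIntegrable]
  have := intervalIntegral.norm_integral_le_of_norm_le_const (a := 0) (b := 1)
    (f := fun t => F i t - f t) (C := ε / 2) fun t ht => by
      rw [uIoc_of_le zero_le_one] at ht
      have := hi t ⟨ht.1.le, ht.2⟩
      rw [dist_comm, dist_eq_norm] at this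
      exact this.le
  simp only [sub_zero, abs_one, mul_one] at this
  linarith

/-! ### Evaluation at atoms -/

theorem MeasureTheory.ae_apply_of_measure_singleton_ne_zero {X : Type*} [MeasurableSpace X]
    {ρ : Measure X} {a : X} (ha : ρ {a} ≠ 0) {p : X → Prop} (h : ∀ᵐ y ∂ρ, p y) : p a := by
  by_contra hp
  exact ha (measure_mono_null (singleton_subset_iff.2 hp) h)

/-- The value of an `L²` class at an atom is its inner product with the indicator of the atom,
divided by the mass. Evaluation thus commutes with integration in time. -/
theorem MeasureTheory.Lp.exists_clm_apply_atom {X : Type*} [MeasurableSpace X]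
    [MeasurableSingletonClass X] {ρ : Measure X} [IsFiniteMeasure ρ] {a : X} (ha : ρ {a} ≠ 0) :
    ∃ T : Lp ℝ 2 ρ →L[ℝ] ℝ, ∀ g : Lp ℝ 2 ρ, T g = g a := by
  have h : ρ.real {a} ≠ 0 := by
    rw [measureReal_def]
    exact ENNReal.toReal_ne_zero.2 ⟨ha, measure_ne_top _ _⟩
  refine ⟨(ρ.real {a})⁻¹ • innerSL ℝ (indicatorConstLp 2 (measurableSet_singleton a)
    (measure_ne_top ρ {a}) (1 : ℝ)), fun g => ?_⟩
  rw [smul_apply, innerSL_apply_apply, L2.inner_indicatorConstLp_one, integral_singleton,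
    smul_eq_mul, smul_eq_mul, inv_mul_cancel_left₀ h]

theorem alphaTilde_eq_of_atom {n : ℕ} {ρ : Measure (Eucl n)} [IsFiniteMeasure ρ] {a : Eucl n}
    (ha : ρ {a} ≠ 0) (η : L2Time (Lp ℝ 2 ρ)) {t : ℝ} (ht : t ∈ Icc (0 : ℝ) 1) :
    alphaTilde η t a = 1 + 1 / 2 * ∫ s in (0 : ℝ)..t, (η s : Eucl n → ℝ) a := by
  obtain ⟨T, hT⟩ := Lp.exists_clm_apply_atom ha
  have hint : IntervalIntegrable (fun s => η s) volume 0 t :=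
    intervalIntegrable_of_mem_unit ((Lp.memLp η).integrable one_le_two) ⟨le_rfl, zero_le_one⟩ ht
  rw [alphaTilde, ← hT, ← T.intervalIntegral_comp_comm hint]
  simp only [hT]

theorem memLp_apply_atom {n : ℕ} {ρ : Measure (Eucl n)} [IsFiniteMeasure ρ] {a : Eucl n}
    (ha : ρ {a} ≠ 0) (η : L2Time (Lp ℝ 2 ρ)) :
    MemLp (fun s => (η s : Eucl n → ℝ) a) 2 (volume.restrict (Icc (0 : ℝ) 1)) := by
  obtain ⟨T, hT⟩ := Lp.exists_clm_apply_atom ha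
  simp only [← hT]
  exact T.comp_memLp η

/-! ### Dual distances -/

section Dual

variable {n d : ℕ} {W : Type*} [NormedAddCommGroup W] [InnerProductSpace ℝ W]
  [RKHS ℝ W (VSpace n d) ℝ]

/-- A real supremum over an unbounded family would be `0` by default; the uniform bound on the unit
ball of `W` and the finite masses rule this out. -/
theorem EmbedsC10.le_dualDist (hW : EmbedsC10 (n := n) (d := d) W) (μ ν : Measure (VSpace n d))
    [IsFiniteMeasure μ] [IsFiniteMeasure ν] (ω : W) (hω : ‖ω‖ ≤ 1) :
    (∫ z, ω z ∂ν) - ∫ z, ω z ∂μ ≤ dualDist W μ ν := by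
  obtain ⟨-, c, hc⟩ := hW
  refine le_ciSup (f := fun ω : {ω : W // ‖ω‖ ≤ 1} => (∫ z, ω.1 z ∂ν) - ∫ z, ω.1 z ∂μ)
    ⟨|c| * ν.real univ + |c| * μ.real univ, ?_⟩ ⟨ω, hω⟩
  rintro _ ⟨ω, rfl⟩
  have h1 : ∀ z, ‖ω.1 z‖ ≤ |c| := fun z => by
    refine ((hc ω.1 z.1).1 z.2).trans ((mul_le_mul_of_nonneg_right (le_abs_self c)
      (norm_nonneg _)).trans (mul_le_of_le_one_right (abs_nonneg c) ω.2))
  have h2 := norm_integral_le_of_norm_le_const (μ := ν) (ae_of_all _ h1)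
  have h3 := norm_integral_le_of_norm_le_const (μ := μ) (ae_of_all _ h1)
  rw [Real.norm_eq_abs] at h2 h3
  have h4 := abs_le.1 h2
  have h5 := abs_le.1 h3
  simp only
  linarith

theorem EmbedsC10.dualDist_nonneg (hW : EmbedsC10 (n := n) (d := d) W)
    (μ ν : Measure (VSpace n d)) [IsFiniteMeasure μ] [IsFiniteMeasure ν] :
    0 ≤ dualDist W μ ν := by
  simpa using hW.le_dualDist μ ν 0 (by simp)

theorem apply_map_span (f : VSpace n d → ℝ) {A : Eucl n →L[ℝ] Eucl n}
    (hA : Function.Injective A) (y : Eucl n) (u : Frame n d) :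
    f (y, OGrass.map A (OGrass.span u)) = frameLift f (y, fun j => A (u.1 j)) := by
  rw [OGrass.map_span hA, frameLift, dif_pos (OGrass.linearIndependent_map hA u)]

theorem EmbedsC10.continuousAt_frameLift (hW : EmbedsC10 (n := n) (d := d) W) (ω : W)
    (y : Eucl n) {u : Fin d → Eucl n} (hu : LinearIndependent ℝ u) :
    ContinuousAt (frameLift (ω : VSpace n d → ℝ)) (y, u) := by
  have hopen : IsOpen {p : Eucl n × (Fin d → Eucl n) | LinearIndependent ℝ p.2} :=
    (isOpen_setOfPred_linearIndependent (𝕜 := ℝ) (E := Eucl n)).preimage continuous_snd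
  exact (hW.1 ω).1.continuousOn.continuousAt (hopen.mem_nhds hu)

/-- Everything is read on the image frames `A i (u j)`, where `frameLift ω` is continuous.
Injectivity keeps `OGrass.map` away from its default value. -/
theorem EmbedsC10.tendsto_apply (hW : EmbedsC10 (n := n) (d := d) W) (ω : W) {ι : Type*}
    {l : Filter ι} {x : ι → Eucl n} {x₀ : Eucl n} {A : ι → Eucl n →L[ℝ] Eucl n}
    {A₀ : Eucl n →L[ℝ] Eucl n} (hx : Tendsto x l (𝓝 x₀)) (hA : Tendsto A l (𝓝 A₀))
    (hAi : ∀ i, Function.Injective (A i)) (hA₀ : Function.Injective A₀) (U : OGrass n d) :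
    Tendsto (fun i => ω (x i, OGrass.map (A i) U)) l (𝓝 (ω (x₀, OGrass.map A₀ U))) := by
  obtain ⟨u, rfl⟩ := OGrass.exists_span U
  have hcoord : ∀ j, Tendsto (fun i => A i (u.1 j)) l (𝓝 (A₀ (u.1 j))) := fun j =>
    ((ContinuousLinearMap.apply ℝ (Eucl n) (u.1 j)).continuous.tendsto A₀).comp hA
  have hlim : Tendsto (fun i => (x i, fun j => A i (u.1 j))) l (𝓝 (x₀, fun j => A₀ (u.1 j))) :=
    hx.prodMk_nhds (tendsto_pi_nhds.2 hcoord)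
  have h := (hW.continuousAt_frameLift ω x₀
    (OGrass.linearIndependent_map hA₀ u)).tendsto.comp hlim
  rw [← apply_map_span (ω : VSpace n d → ℝ) hA₀] at h
  exact h.congr fun i => (apply_map_span (ω : VSpace n d → ℝ) (hAi i) _ u).symm

end Dual

/-! ### The reduced problem -/

/-- Among the rates `h` of given integral, the weighted energy `∫ h² J` is minimal when `h` is
proportional to `1 / J`. -/
theorem sq_integral_div_le {h J : ℝ → ℝ} (hh : MemLp h 2 (volume.restrict (Icc (0 : ℝ) 1)))
    (hJ : ContinuousOn J (Icc 0 1)) (hJ0 : ∀ t ∈ Icc (0 : ℝ) 1, 0 < J t)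
    (hT : 0 < ∫ t in (0 : ℝ)..1, (J t)⁻¹) :
    (∫ t in (0 : ℝ)..1, h t) ^ 2 / (∫ t in (0 : ℝ)..1, (J t)⁻¹) ≤
      ∫ t in (0 : ℝ)..1, h t ^ 2 * J t := by
  have h0 : (0 : ℝ) ∈ Icc (0 : ℝ) 1 := ⟨le_rfl, zero_le_one⟩
  have h1 : (1 : ℝ) ∈ Icc (0 : ℝ) 1 := ⟨zero_le_one, le_rfl⟩
  set T := ∫ t in (0 : ℝ)..1, (J t)⁻¹ with hTdef
  set I := ∫ t in (0 : ℝ)..1, h t with hI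
  have i1 : IntervalIntegrable h volume 0 1 :=
    intervalIntegrable_of_mem_unit (hh.integrable one_le_two) h0 h1
  have i2 : IntervalIntegrable (fun t => (J t)⁻¹) volume 0 1 := by
    refine ContinuousOn.intervalIntegrable ?_
    rw [uIcc_of_le zero_le_one]
    exact hJ.inv₀ fun t ht => (hJ0 t ht).ne'
  have i3 : IntervalIntegrable (fun t => h t ^ 2 * J t) volume 0 1 :=
    intervalIntegrable_of_mem_unit
      (IntegrableOn.mul_continuousOn hh.integrable_sq hJ isCompact_Icc) h0 h1
  have hle : ∫ t in (0 : ℝ)..1, (2 * (I / T) * h t - (I / T) ^ 2 * (J t)⁻¹) ≤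
      ∫ t in (0 : ℝ)..1, h t ^ 2 * J t := by
    refine intervalIntegral.integral_mono_on zero_le_one
      ((i1.const_mul _).sub (i2.const_mul _)) i3 fun t ht => ?_
    have hJt := hJ0 t ht
    -- The square vanishes exactly for the optimal rate `h = (I / T) / J`, whose integral is `I`.
    have : 0 ≤ (h t * J t - I / T) ^ 2 * (J t)⁻¹ := by positivity
    have e : (h t * J t - I / T) ^ 2 * (J t)⁻¹ =
        h t ^ 2 * J t - (2 * (I / T) * h t - (I / T) ^ 2 * (J t)⁻¹) := by
      field_simp
      ring
    linarith
  rw [intervalIntegral.integral_sub (i1.const_mul _) (i2.const_mul _),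
    intervalIntegral.integral_const_mul, intervalIntegral.integral_const_mul, ← hI, ← hTdef] at hle
  refine le_of_eq_of_le ?_ hle
  field_simp
  ring

/-! ### Splitting of the cost over the positions of the atoms. -/

section Reduced

variable {n d N : ℕ} (r : Fin N → ℝ) (x : Fin N → Eucl n) (U : Fin N → OGrass n d)

open Classical in
/-- The mass created at the atom `a` by the unit weight change when `A` is the differential of the
deformation at `a`. -/
def atomDensity (a : Eucl n) (A : Eucl n →L[ℝ] Eucl n) : ℝ :=
  ∑ i with x i = a, r i * OGrass.jac A (U i)

/-- The integral `∫₀¹ dt / J_t` of the inverse of the density at the atom `a` along a flow. -/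
def atomTime {V : Type*} [NormedAddCommGroup V] [InnerProductSpace ℝ V]
    [RKHS ℝ V (Eucl n) (Eucl n)] (v : L2Time V) (a : Eucl n) : ℝ :=
  ∫ t in (0 : ℝ)..1, (atomDensity r x U a (fderiv ℝ (flowMap (v : ℝ → V) t) a))⁻¹

open Classical in
/-- The least relaxed cost among the weight changes with final value `β`. -/
def reducedCost {V : Type*} [NormedAddCommGroup V] [InnerProductSpace ℝ V]
    [RKHS ℝ V (Eucl n) (Eucl n)] (W : Type*) [NormedAddCommGroup W] [InnerProductSpace ℝ W]
    [RKHS ℝ W (VSpace n d) ℝ] (γ lam : ℝ) (μtar : Measure (VSpace n d)) (v : L2Time V)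
    (β : Eucl n → ℝ) : ℝ :=
  1 / 2 * ‖v‖ ^ 2 + ∑ a ∈ Finset.univ.image x, 2 * γ * ((β a - 1) ^ 2 / atomTime r x U v a) +
    lam / 2 * dualDist W (metaAction (flowMap (v : ℝ → V) 1) (fun y => β y ^ 2)
      (discreteVarifold r x U)) μtar ^ 2

variable {r x U}

theorem atomDensity_pos (hr : ∀ i, 0 < r i) {a : Eucl n} (ha : a ∈ range x)
    {A : Eucl n →L[ℝ] Eucl n} (hA : Function.Injective A) : 0 < atomDensity r x U a A := by
  classical
  obtain ⟨i, rfl⟩ := ha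
  exact Finset.sum_pos (fun j _ => mul_pos (hr j) (OGrass.jac_pos hA _))
    ⟨i, Finset.mem_filter.2 ⟨Finset.mem_univ i, rfl⟩⟩

theorem continuous_atomDensity (a : Eucl n) : Continuous (atomDensity r x U a) :=
  continuous_finsetSum _ fun _ _ => continuous_const.mul (OGrass.continuous_jac _)

-- The weight change depends on the position alone, while several oriented subspaces may share a
-- position; their contributions are grouped.
open Classical in
theorem sum_mul_jac_eq_sum_atomDensity (g : Eucl n → ℝ) (B : Eucl n → Eucl n →L[ℝ] Eucl n) :
    ∑ i, r i * (g (x i) * OGrass.jac (B (x i)) (U i)) =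
      ∑ a ∈ Finset.univ.image x, g a * atomDensity r x U a (B a) := by
  rw [← Finset.sum_fiberwise_of_maps_to (t := Finset.univ.image x) (g := x)
    fun i hi => Finset.mem_image_of_mem x hi]
  refine Finset.sum_congr rfl fun a _ => ?_
  rw [atomDensity, Finset.mul_sum]
  refine Finset.sum_congr rfl fun i hi => ?_
  rw [(Finset.mem_filter.1 hi).2]
  ring

theorem weight_singleton_ne_zero (hr : ∀ i, 0 < r i) {a : Eucl n} (ha : a ∈ range x) :
    weight (discreteVarifold r x U) {a} ≠ 0 := by
  obtain ⟨i, rfl⟩ := ha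
  rw [weight_discreteVarifold, Measure.finsetSum_apply]
  refine fun h => (ENNReal.ofReal_pos.2 (hr i)).ne' ?_
  have := (Finset.sum_eq_zero_iff.1 h) i (Finset.mem_univ i)
  simpa using this

theorem ae_weight_of_forall {p : Eucl n → Prop} (h : ∀ a ∈ range x, p a) :
    ∀ᵐ y ∂weight (discreteVarifold r x U), p y := by
  rw [weight_discreteVarifold, ae_finsetSum_measure_iff]
  intro i _
  refine Measure.ae_smul_measure ?_ _
  rw [ae_dirac_eq]
  exact h _ (mem_range_self i)

theorem isFiniteMeasure_metaAction (hr : ∀ i, 0 < r i) (φ : Eucl n → Eucl n)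
    (β : Eucl n → ℝ) :
    IsFiniteMeasure (metaAction φ (fun y => β y ^ 2) (discreteVarifold r x U)) := by
  rw [metaAction_discreteVarifold x U (fun i => (hr i).le) φ _ fun _ => sq_nonneg _]
  infer_instance

theorem metaAction_congr (hr : ∀ i, 0 < r i) (φ : Eucl n → Eucl n) {β β' : Eucl n → ℝ}
    (h : ∀ a ∈ range x, β a ^ 2 = β' a ^ 2) :
    metaAction φ (fun y => β y ^ 2) (discreteVarifold r x U) =
      metaAction φ (fun y => β' y ^ 2) (discreteVarifold r x U) := by
  rw [metaAction_discreteVarifold x U (fun i => (hr i).le) φ _ fun _ => sq_nonneg _,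
    metaAction_discreteVarifold x U (fun i => (hr i).le) φ _ fun _ => sq_nonneg _]
  simp only [h _ (mem_range_self _)]

/-! ### Optimal weight changes along a given flow. -/

variable {V : Type*} [NormedAddCommGroup V] [InnerProductSpace ℝ V]
  [RKHS ℝ V (Eucl n) (Eucl n)] {c : ℝ}

theorem continuousOn_atomDensity_flowMap (hb : HasC2Bound (n := n) V c) (v : L2Time V)
    (a : Eucl n) :
    ContinuousOn (fun t => atomDensity r x U a (fderiv ℝ (flowMap (v : ℝ → V) t) a))
      (Icc 0 1) :=
  (continuous_atomDensity a).comp_continuousOn (hb.continuousOn_fderiv_flowMap v a)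

theorem atomDensity_flowMap_pos (hb : HasC2Bound (n := n) V c) (hr : ∀ i, 0 < r i) (v : L2Time V)
    {a : Eucl n} (ha : a ∈ range x) {t : ℝ} (ht : t ∈ Icc (0 : ℝ) 1) :
    0 < atomDensity r x U a (fderiv ℝ (flowMap (v : ℝ → V) t) a) :=
  atomDensity_pos hr ha (hb.injective_fderiv_flowMap v a ht)

theorem continuousOn_inv_atomDensity_flowMap (hb : HasC2Bound (n := n) V c) (hr : ∀ i, 0 < r i)
    (v : L2Time V) {a : Eucl n} (ha : a ∈ range x) :
    ContinuousOn (fun t => (atomDensity r x U a (fderiv ℝ (flowMap (v : ℝ → V) t) a))⁻¹)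
      (Icc 0 1) :=
  (continuousOn_atomDensity_flowMap hb v a).inv₀ fun _ ht =>
    (atomDensity_flowMap_pos hb hr v ha ht).ne'

theorem atomTime_pos (hb : HasC2Bound (n := n) V c) (hr : ∀ i, 0 < r i) (v : L2Time V)
    {a : Eucl n} (ha : a ∈ range x) : 0 < atomTime r x U v a :=
  intervalIntegral.intervalIntegral_pos_of_pos_on
    (ContinuousOn.intervalIntegrable (by
      rw [uIcc_of_le zero_le_one]; exact continuousOn_inv_atomDensity_flowMap hb hr v ha))
    (fun _ ht => inv_pos.2 (atomDensity_flowMap_pos hb hr v ha (Ioo_subset_Icc_self ht)))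
    zero_lt_one

theorem tendsto_atomTime (hb : HasC2Bound (n := n) V c) (hr : ∀ i, 0 < r i) {ι : Type*}
    {l : Filter ι} {u : ι → L2Time V} {v : L2Time V} {M : ℝ} (hM : ∀ i, ‖u i‖ ≤ M)
    (huv : ∀ T : L2Time V →L[ℝ] ℝ, Tendsto (fun i => T (u i)) l (𝓝 (T v))) {a : Eucl n}
    (ha : a ∈ range x) :
    Tendsto (fun i => atomTime r x U (u i) a) l (𝓝 (atomTime r x U v a)) :=
  ((hb.tendstoUniformlyOn_fderiv_flowMap hM huv a).comp_continuousAt_of_isCompact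
    (g := fun A => (atomDensity r x U a A)⁻¹) isCompact_Icc (hb.continuousOn_fderiv_flowMap v a)
    fun _ ht => (continuous_atomDensity a).continuousAt.inv₀
      (atomDensity_flowMap_pos hb hr v ha ht).ne').tendsto_integral_unit
    (fun i => continuousOn_inv_atomDensity_flowMap hb hr (u i) ha)
    (continuousOn_inv_atomDensity_flowMap hb hr v ha)

open Classical in
theorem relaxedCost_eq (W : Type*) [NormedAddCommGroup W] [InnerProductSpace ℝ W]
    [RKHS ℝ W (VSpace n d) ℝ] (hb : HasC2Bound (n := n) V c) (hr : ∀ i, 0 < r i) (γ lam : ℝ)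
    (μtar : Measure (VSpace n d)) (v : L2Time V)
    (η : L2Time (Lp ℝ 2 (weight (discreteVarifold r x U)))) :
    relaxedCost W γ lam (discreteVarifold r x U) μtar v η =
      1 / 2 * ‖v‖ ^ 2 + ∑ a ∈ Finset.univ.image x, γ / 2 * (∫ t in (0 : ℝ)..1,
        (η t : Eucl n → ℝ) a ^ 2 *
          atomDensity r x U a (fderiv ℝ (flowMap (v : ℝ → V) t) a)) +
      lam / 2 * dualDist W (metaAction (flowMap (v : ℝ → V) 1)
        (fun y => alphaTilde η 1 y ^ 2) (discreteVarifold r x U)) μtar ^ 2 := by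
  have h0 : (0 : ℝ) ∈ Icc (0 : ℝ) 1 := ⟨le_rfl, zero_le_one⟩
  have h1 : (1 : ℝ) ∈ Icc (0 : ℝ) 1 := ⟨zero_le_one, le_rfl⟩
  rw [relaxedCost, L2Time.integral_sq_norm, ← Finset.mul_sum, ← intervalIntegral.integral_finsetSum]
  · simp only [integral_discreteVarifold x U fun i => (hr i).le]
    congr 4
    ext t
    exact sum_mul_jac_eq_sum_atomDensity (fun y => (η t : Eucl n → ℝ) y ^ 2)
      (fun y => fderiv ℝ (flowMap (v : ℝ → V) t) y)
  · intro a ha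
    have ha' : a ∈ range x := by simpa using ha
    exact intervalIntegrable_of_mem_unit (IntegrableOn.mul_continuousOn
      (memLp_apply_atom (weight_singleton_ne_zero hr ha') η).integrable_sq
      (continuousOn_atomDensity_flowMap hb v a) isCompact_Icc) h0 h1

/-- With `I = ∫ η`, one has `alphaTilde = 1 + I / 2` at time `1`, and `(|α| - 1)² ≤ (α - 1)² = I² /
4`. The energy bound at each atom concludes, since the data term depends only on `α²`. -/
theorem reducedCost_abs_alphaTilde_le (W : Type*) [NormedAddCommGroup W] [InnerProductSpace ℝ W]
    [RKHS ℝ W (VSpace n d) ℝ] (hb : HasC2Bound (n := n) V c) (hr : ∀ i, 0 < r i) {γ : ℝ}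
    (hγ : 0 < γ) (lam : ℝ) (μtar : Measure (VSpace n d)) (v : L2Time V)
    (η : L2Time (Lp ℝ 2 (weight (discreteVarifold r x U)))) :
    reducedCost r x U W γ lam μtar v (fun y => |alphaTilde η 1 y|) ≤
      relaxedCost W γ lam (discreteVarifold r x U) μtar v η := by
  classical
  have h1 : (1 : ℝ) ∈ Icc (0 : ℝ) 1 := ⟨zero_le_one, le_rfl⟩
  rw [relaxedCost_eq W hb hr, reducedCost]
  simp only [sq_abs]
  refine add_le_add_left (add_le_add_right (Finset.sum_le_sum fun a ha => ?_) _) _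
  have ha' : a ∈ range x := by simpa using ha
  have hT := atomTime_pos (U := U) hb hr v ha'
  have hρ := weight_singleton_ne_zero (U := U) hr ha'
  have key := sq_integral_div_le (memLp_apply_atom hρ η) (continuousOn_atomDensity_flowMap hb v a)
    (fun t ht => atomDensity_flowMap_pos hb hr v ha' ht) hT
  have hα := alphaTilde_eq_of_atom hρ η h1
  set I := ∫ t in (0 : ℝ)..1, (η t : Eucl n → ℝ) a
  have hab : (|alphaTilde η 1 a| - 1) ^ 2 ≤ I ^ 2 / 4 := by
    have e : I ^ 2 / 4 = (alphaTilde η 1 a - 1) ^ 2 := by rw [hα]; ring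
    rw [e]
    nlinarith [le_abs_self (alphaTilde η 1 a), sq_abs (alphaTilde η 1 a)]
  have h2 : (|alphaTilde η 1 a| - 1) ^ 2 / atomTime r x U v a ≤ I ^ 2 / 4 / atomTime r x U v a :=
    div_le_div_of_nonneg_right hab hT.le
  have h3 : I ^ 2 / 4 / atomTime r x U v a = 1 / 4 * (I ^ 2 / atomTime r x U v a) := by ring
  have h4 : I ^ 2 / atomTime r x U v a ≤ _ := key
  calc _ ≤ 2 * γ * (1 / 4 * (I ^ 2 / atomTime r x U v a)) := by
        rw [← h3]; exact mul_le_mul_of_nonneg_left h2 (by positivity)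
    _ = γ / 2 * (I ^ 2 / atomTime r x U v a) := by ring
    _ ≤ _ := mul_le_mul_of_nonneg_left h4 (by positivity)

/-- Paths in `L²(ρ)` with prescribed values at finitely many atoms of `ρ`. -/
theorem exists_L2Time_apply_atom_eq {ρ : Measure (Eucl n)} [IsFiniteMeasure ρ]
    (S : Finset (Eucl n)) (hS : ∀ a ∈ S, ρ {a} ≠ 0) {f : Eucl n → ℝ → ℝ}
    (hf : ∀ a ∈ S, ContinuousOn (f a) (Icc 0 1)) :
    ∃ η : L2Time (Lp ℝ 2 ρ), ∀ a ∈ S, ∀ᵐ t ∂volume.restrict (Icc (0 : ℝ) 1),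
      (η t : Eucl n → ℝ) a = f a t := by
  classical
  let e : Eucl n → Lp ℝ 2 ρ := fun a =>
    indicatorConstLp 2 (measurableSet_singleton a) (measure_ne_top ρ {a}) (1 : ℝ)
  let g : ℝ → Lp ℝ 2 ρ := fun t => ∑ a ∈ S, f a t • e a
  have hg : ContinuousOn g (Icc 0 1) :=
    continuousOn_finsetSum _ fun a ha => (hf a ha).smul continuousOn_const
  obtain ⟨B, hB⟩ := isCompact_Icc.exists_bound_of_continuousOn hg
  have hmem : MemLp g 2 (volume.restrict (Icc (0 : ℝ) 1)) :=
    MemLp.of_bound (hg.aestronglyMeasurable measurableSet_Icc) B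
      ((ae_restrict_iff' measurableSet_Icc).2 (ae_of_all _ hB))
  refine ⟨hmem.toLp g, fun a ha => ?_⟩
  obtain ⟨T, hT⟩ := Lp.exists_clm_apply_atom (hS a ha)
  filter_upwards [hmem.coeFn_toLp] with t ht
  have he : ∀ b, T (e b) = if a = b then 1 else 0 := fun b => by
    have := ae_apply_of_measure_singleton_ne_zero (hS a ha) (indicatorConstLp_coeFn (p := 2)
      (hs := measurableSet_singleton b) (hμs := measure_ne_top ρ {b}) (c := (1 : ℝ)))
    rw [hT, this]
    simp [indicator]
  rw [ht, ← hT]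
  simp [g, he, ha]

/-- The rate inversely proportional to the density attains equality in the energy bound. It moves
the weight monotonically from `1` to `β`, so the weight never becomes negative. -/
theorem exists_relaxedCost_eq_reducedCost (W : Type*) [NormedAddCommGroup W]
    [InnerProductSpace ℝ W] [RKHS ℝ W (VSpace n d) ℝ] (hb : HasC2Bound (n := n) V c)
    (hr : ∀ i, 0 < r i) (γ lam : ℝ) (μtar : Measure (VSpace n d)) (v : L2Time V)
    {β : Eucl n → ℝ} (hβ : ∀ y, 0 ≤ β y) :
    ∃ η : L2Time (Lp ℝ 2 (weight (discreteVarifold r x U))),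
      (∀ t ∈ Icc (0 : ℝ) 1, ∀ᵐ y ∂weight (discreteVarifold r x U), 0 ≤ alphaTilde η t y) ∧
      relaxedCost W γ lam (discreteVarifold r x U) μtar v η =
        reducedCost r x U W γ lam μtar v β := by
  classical
  have h1 : (1 : ℝ) ∈ Icc (0 : ℝ) 1 := ⟨zero_le_one, le_rfl⟩
  have hS : ∀ a ∈ Finset.univ.image x, a ∈ range x := fun a ha => by simpa using ha
  let J : Eucl n → ℝ → ℝ := fun a t =>
    atomDensity r x U a (fderiv ℝ (flowMap (v : ℝ → V) t) a)
  obtain ⟨η, hη⟩ := exists_L2Time_apply_atom_eq (Finset.univ.image x)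
    (fun a ha => weight_singleton_ne_zero (U := U) hr (hS a ha))
    -- The factor `2 / atomTime` compensates the `1 / 2` in `alphaTilde` and normalizes the integral
    -- of `J⁻¹`, so that the final value is `β a`.
    (f := fun a t => 2 * (β a - 1) / atomTime r x U v a * (J a t)⁻¹)
    fun a ha => continuousOn_const.mul (continuousOn_inv_atomDensity_flowMap hb hr v (hS a ha))
  have hα : ∀ a ∈ range x, ∀ t ∈ Icc (0 : ℝ) 1, alphaTilde η t a =
      1 + (β a - 1) * ((∫ s in (0 : ℝ)..t, (J a s)⁻¹) / atomTime r x U v a) := by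
    intro a ha t ht
    rw [alphaTilde_eq_of_atom (weight_singleton_ne_zero hr ha) η ht,
      intervalIntegral.integral_of_le ht.1, intervalIntegral.integral_of_le ht.1]
    rw [integral_congr_ae (ae_restrict_of_ae_restrict_of_subset
      (fun s hs => ⟨hs.1.le, hs.2.trans ht.2⟩ : Ioc 0 t ⊆ Icc 0 1)
      (hη a (by simpa using ha))), integral_const_mul]
    ring
  have hα1 : ∀ a ∈ range x, alphaTilde η 1 a = β a := by
    intro a ha
    have hT := atomTime_pos (U := U) hb hr v ha
    rw [hα a ha 1 h1]
    change 1 + (β a - 1) * (atomTime r x U v a / atomTime r x U v a) = β a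
    rw [div_self hT.ne']
    ring
  refine ⟨η, fun t ht => ae_weight_of_forall fun a ha => ?_, ?_⟩
  · have hT := atomTime_pos (U := U) hb hr v ha
    have hpos : ∀ s ∈ Icc (0 : ℝ) 1, 0 < (J a s)⁻¹ := fun s hs =>
      inv_pos.2 (atomDensity_flowMap_pos hb hr v ha hs)
    have hint : IntervalIntegrable (fun s => (J a s)⁻¹) volume 0 1 :=
      ContinuousOn.intervalIntegrable (by
        rw [uIcc_of_le zero_le_one]; exact continuousOn_inv_atomDensity_flowMap hb hr v ha)
    have hle : ∫ s in (0 : ℝ)..t, (J a s)⁻¹ ≤ atomTime r x U v a :=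
      intervalIntegral.integral_mono_interval le_rfl ht.1 ht.2
        ((ae_restrict_iff' measurableSet_Ioc).2
          (ae_of_all _ fun s hs => (hpos s (Ioc_subset_Icc_self hs)).le)) hint
    have h0 : 0 ≤ ∫ s in (0 : ℝ)..t, (J a s)⁻¹ :=
      intervalIntegral.integral_nonneg ht.1 fun s hs => (hpos s ⟨hs.1, hs.2.trans ht.2⟩).le
    rw [hα a ha t ht]
    have hθ1 := (div_le_one hT).2 hle
    have hθ0 := div_nonneg h0 hT.le
    -- With `θ` the elapsed fraction of `atomTime`, the weight is `(1 - θ) + β a * θ`.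
    nlinarith [mul_nonneg (hβ a) hθ0]
  · rw [relaxedCost_eq W hb hr, reducedCost,
      metaAction_congr hr _ fun a ha => by rw [hα1 a ha]]
    refine congrArg₂ _ (congrArg₂ _ rfl (Finset.sum_congr rfl fun a ha => ?_)) rfl
    have ha' := hS a ha
    have hT := atomTime_pos (U := U) hb hr v ha'
    have hcost : ∫ t in (0 : ℝ)..1, (η t : Eucl n → ℝ) a ^ 2 * J a t =
        (2 * (β a - 1) / atomTime r x U v a) ^ 2 * atomTime r x U v a := by
      rw [atomTime, ← intervalIntegral.integral_const_mul,
        intervalIntegral.integral_of_le zero_le_one, intervalIntegral.integral_of_le zero_le_one]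
      refine integral_congr_ae ?_
      filter_upwards [ae_restrict_of_ae_restrict_of_subset Ioc_subset_Icc_self (hη a ha),
        ae_restrict_mem measurableSet_Ioc] with t ht htI
      have hJ : J a t ≠ 0 := (atomDensity_flowMap_pos hb hr v ha' (Ioc_subset_Icc_self htI)).ne'
      rw [ht, mul_pow]
      change _ = _ * (J a t)⁻¹
      rw [atomTime]
      field_simp
    change γ / 2 * (∫ t in (0 : ℝ)..1, (η t : Eucl n → ℝ) a ^ 2 * J a t) = _
    rw [hcost]
    field_simp

end Reduced

/-! ### Existence for the reduced problem by the direct method. -/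

section Existence

variable {n d N : ℕ} {r : Fin N → ℝ} {x : Fin N → Eucl n} {U : Fin N → OGrass n d}
  {V : Type*} [NormedAddCommGroup V] [InnerProductSpace ℝ V] [RKHS ℝ V (Eucl n) (Eucl n)] {c : ℝ}
  {W : Type*} [NormedAddCommGroup W] [InnerProductSpace ℝ W] [RKHS ℝ W (VSpace n d) ℝ]

theorem tendsto_integral_metaAction (hb : HasC2Bound (n := n) V c) (hr : ∀ i, 0 < r i)
    (hW : EmbedsC10 (n := n) (d := d) W) (ω : W) {ι : Type*} {l : Filter ι} {u : ι → L2Time V}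
    {v : L2Time V} {M : ℝ} (hM : ∀ i, ‖u i‖ ≤ M)
    (huv : ∀ T : L2Time V →L[ℝ] ℝ, Tendsto (fun i => T (u i)) l (𝓝 (T v)))
    {b : ι → Eucl n → ℝ} {β : Eucl n → ℝ}
    (hbβ : ∀ a ∈ range x, Tendsto (fun i => b i a) l (𝓝 (β a))) :
    Tendsto (fun i => ∫ z, ω z ∂metaAction (flowMap (u i : ℝ → V) 1) (fun y => b i y ^ 2)
        (discreteVarifold r x U)) l
      (𝓝 (∫ z, ω z ∂metaAction (flowMap (v : ℝ → V) 1) (fun y => β y ^ 2)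
        (discreteVarifold r x U))) := by
  have h1 : (1 : ℝ) ∈ Icc (0 : ℝ) 1 := ⟨zero_le_one, le_rfl⟩
  have hint : ∀ (w : L2Time V) (β : Eucl n → ℝ),
      ∫ z, ω z ∂metaAction (flowMap (w : ℝ → V) 1) (fun y => β y ^ 2)
        (discreteVarifold r x U) =
      ∑ i, r i * β (x i) ^ 2 * OGrass.jac (fderiv ℝ (flowMap (w : ℝ → V) 1) (x i)) (U i) *
        ω (flowMap (w : ℝ → V) 1 (x i),
          OGrass.map (fderiv ℝ (flowMap (w : ℝ → V) 1) (x i)) (U i)) := fun w β => by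
    rw [metaAction_discreteVarifold x U (fun i => (hr i).le) _ _ fun _ => sq_nonneg _,
      integral_discreteVarifold _ _ fun i => mul_nonneg
        (mul_nonneg (hr i).le (sq_nonneg _)) (OGrass.jac_nonneg _ _)]
  simp only [hint]
  refine tendsto_finsetSum _ fun i _ => ?_
  have hφ := (hb.tendstoUniformlyOn_flowMap hM huv (x i)).tendsto_at h1
  have hA := (hb.tendstoUniformlyOn_fderiv_flowMap hM huv (x i)).tendsto_at h1
  refine Tendsto.mul (Tendsto.mul (((hbβ _ (mem_range_self i)).pow 2).const_mul _) ?_) ?_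
  · exact ((OGrass.continuous_jac (U i)).tendsto _).comp hA
  · exact hW.tendsto_apply ω hφ hA (fun j => hb.injective_fderiv_flowMap (u j) _ h1)
      (hb.injective_fderiv_flowMap v _ h1) (U i)

/-- Coercivity: the summands are nonnegative, so a bound on the cost bounds each of them. -/
theorem le_reducedCost (hb : HasC2Bound (n := n) V c) (hr : ∀ i, 0 < r i) {γ lam : ℝ}
    (hγ : 0 < γ) (hlam : 0 < lam) (μtar : Measure (VSpace n d)) (v : L2Time V)
    (β : Eucl n → ℝ) :
    1 / 2 * ‖v‖ ^ 2 ≤ reducedCost r x U W γ lam μtar v β ∧ ∀ a ∈ range x,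
      2 * γ * ((β a - 1) ^ 2 / atomTime r x U v a) ≤ reducedCost r x U W γ lam μtar v β := by
  classical
  have hterm : ∀ a ∈ Finset.univ.image x,
      0 ≤ 2 * γ * ((β a - 1) ^ 2 / atomTime r x U v a) := fun a ha =>
    mul_nonneg (by positivity) (div_nonneg (sq_nonneg _)
      (atomTime_pos hb hr v (by simpa using ha)).le)
  have hsum := Finset.sum_nonneg hterm
  have hdual : 0 ≤ lam / 2 * dualDist W (metaAction (flowMap (v : ℝ → V) 1) (fun y => β y ^ 2)
    (discreteVarifold r x U)) μtar ^ 2 := by positivity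
  have hv : 0 ≤ 1 / 2 * ‖v‖ ^ 2 := by positivity
  refine ⟨?_, fun a ha => ?_⟩
  · rw [reducedCost]
    linarith
  · have := Finset.single_le_sum hterm (show a ∈ Finset.univ.image x by simpa using ha)
    rw [reducedCost]
    linarith

theorem exists_forall_reducedCost_le [CompleteSpace V] (hb : HasC2Bound (n := n) V c)
    (hr : ∀ i, 0 < r i) (hW : EmbedsC10 (n := n) (d := d) W) {γ lam : ℝ} (hγ : 0 < γ)
    (hlam : 0 < lam) (μtar : Measure (VSpace n d)) [IsFiniteMeasure μtar] :
    ∃ (v : L2Time V) (β : Eucl n → ℝ), (∀ y, 0 ≤ β y) ∧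
      ∀ (v' : L2Time V) (β' : Eucl n → ℝ), (∀ y, 0 ≤ β' y) →
        reducedCost r x U W γ lam μtar v β ≤ reducedCost r x U W γ lam μtar v' β' := by
  classical
  set F : L2Time V → (Eucl n → ℝ) → ℝ := reducedCost r x U W γ lam μtar with hF
  have hF0 : ∀ v β, 0 ≤ F v β := fun v β =>
    (by positivity : (0 : ℝ) ≤ 1 / 2 * ‖v‖ ^ 2).trans (le_reducedCost hb hr hγ hlam μtar v β).1
  let C : Set ℝ := {m | ∃ v β, (∀ y, 0 ≤ β y) ∧ F v β = m}
  have hC : C.Nonempty := ⟨_, 0, 0, fun _ => le_rfl, rfl⟩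
  have hCb : BddBelow C := ⟨0, by rintro _ ⟨v, β, -, rfl⟩; exact hF0 v β⟩
  obtain ⟨m, hm_anti, hm, hmC⟩ := exists_seq_tendsto_sInf hC hCb
  choose u b hb0 hub using hmC
  have hm0 : ∀ k, m k ≤ m 0 := fun k => hm_anti (Nat.zero_le k)
  have hM : ∀ k, ‖u k‖ ≤ √(2 * m 0) := fun k => by
    have := (le_reducedCost (W := W) (x := x) (U := U) hb hr hγ hlam μtar (u k) (b k)).1
    refine Real.le_sqrt_of_sq_le ?_
    have h2 := hub k
    have h3 := hm0 k
    rw [hF] at h2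
    linarith
  -- Along one ultrafilter finer than `atTop` all bounded quantities converge, so no subsequences
  -- are extracted.
  let l : Ultrafilter ℕ := hyperfilter ℕ
  have hl : (l : Filter ℕ) ≤ atTop := Nat.cofinite_eq_atTop ▸ hyperfilter_le_cofinite
  obtain ⟨v, huv⟩ := l.exists_weak_limit hM
  have hlimβ : ∀ a ∈ range x, ∃ β, 0 ≤ β ∧ Tendsto (fun k => b k a) l (𝓝 β) := by
    intro a ha
    have hT := tendsto_atomTime (U := U) hb hr hM huv ha
    have hTv := atomTime_pos (U := U) hb hr v ha
    -- Along `l` the times `atomTime` are eventually below their limit plus one, and the energy term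
    -- is at most `m 0`; together they bound `(b k a - 1)²`.
    set R := 1 + √(m 0 / (2 * γ) * (atomTime r x U v a + 1)) with hR
    have hev : ∀ᶠ k in (l : Filter ℕ), b k a ∈ Icc 0 R := by
      filter_upwards [hT.eventually (gt_mem_nhds (lt_add_one _))] with k hk
      refine ⟨hb0 k a, ?_⟩
      have hTk := atomTime_pos (U := U) hb hr (u k) ha
      have h1 := (le_reducedCost (W := W) (U := U) hb hr hγ hlam μtar (u k) (b k)).2 a ha
      have h2 := hub k
      have h3 := hm0 k
      rw [hF] at h2
      rw [h2] at h1
      have h4 : (b k a - 1) ^ 2 / atomTime r x U (u k) a ≤ m 0 / (2 * γ) := by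
        rw [le_div_iff₀ (by positivity)]
        linarith
      have h5 : 0 ≤ m 0 / (2 * γ) := (div_nonneg (sq_nonneg _) hTk.le).trans h4
      have h6 : (b k a - 1) ^ 2 ≤ m 0 / (2 * γ) * (atomTime r x U v a + 1) :=
        ((div_le_iff₀ hTk).1 h4).trans (mul_le_mul_of_nonneg_left hk.le h5)
      have h7 := Real.le_sqrt_of_sq_le h6
      rw [hR]
      linarith
    obtain ⟨β, hβ, hβl⟩ := (isCompact_Icc (a := (0 : ℝ)) (b := R)).ultrafilter_le_nhds'
      (l.map fun k => b k a) (Ultrafilter.mem_map.2 hev)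
    exact ⟨β, hβ.1, hβl⟩
  choose! β₀ hβ₀ hβl using hlimβ
  let β : Eucl n → ℝ := fun y => if y ∈ range x then β₀ y else 0
  have hβ : ∀ y, 0 ≤ β y := fun y => by
    by_cases hy : y ∈ range x
    · simpa only [β, if_pos hy] using hβ₀ y hy
    · simp only [β, if_neg hy, le_refl]
  have hbβ : ∀ a ∈ range x, Tendsto (fun k => b k a) l (𝓝 (β a)) := fun a ha => by
    simpa only [β, if_pos ha] using hβl a ha
  refine ⟨v, β, hβ, fun v' β' hβ' => ?_⟩
  refine le_trans ?_ (csInf_le hCb ⟨v', β', hβ', rfl⟩)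
  have hfin : ∀ (w : L2Time V) (β : Eucl n → ℝ), IsFiniteMeasure
      (metaAction (flowMap (w : ℝ → V) 1) (fun y => β y ^ 2) (discreteVarifold r x U)) :=
    fun w β => isFiniteMeasure_metaAction hr _ β
  set D := dualDist W (metaAction (flowMap (v : ℝ → V) 1) (fun y => β y ^ 2)
    (discreteVarifold r x U)) μtar with hD
  have hD0 : 0 ≤ D := have := hfin v β; hW.dualDist_nonneg _ _
  set Q : L2Time V → (Eucl n → ℝ) → ℝ := fun v β =>
    ∑ a ∈ Finset.univ.image x, 2 * γ * ((β a - 1) ^ 2 / atomTime r x U v a) with hQ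
  have hQlim : Tendsto (fun k => Q (u k) (b k)) l (𝓝 (Q v β)) := by
    refine tendsto_finsetSum _ fun a ha => ?_
    have ha' : a ∈ range x := by simpa using ha
    exact ((((hbβ a ha').sub_const 1).pow 2).div (tendsto_atomTime hb hr hM huv ha')
      (atomTime_pos hb hr v ha').ne').const_mul _
  -- Lower semicontinuity by linearization: `‖u‖² / 2 ≥ ⟪v, u⟫ - ‖v‖² / 2` and `Dk² ≥ 2 D Dk - D²`,
  -- with `Dk` bounded below by the pairing with `ω`. The resulting lower bounds pass to the limit.
  have hmain : ∀ ω : {ω : W // ‖ω‖ ≤ 1}, D * ((∫ z, ω.1 z ∂μtar) -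
      ∫ z, ω.1 z ∂metaAction (flowMap (v : ℝ → V) 1) (fun y => β y ^ 2)
        (discreteVarifold r x U)) ≤
      (sInf C - 1 / 2 * ‖v‖ ^ 2 - Q v β + lam / 2 * D ^ 2) / lam := by
    rintro ⟨ω, hω⟩
    set val : L2Time V → (Eucl n → ℝ) → ℝ := fun v β => (∫ z, ω z ∂μtar) -
      ∫ z, ω z ∂metaAction (flowMap (v : ℝ → V) 1) (fun y => β y ^ 2)
        (discreteVarifold r x U) with hval
    have hvlim : Tendsto (fun k => val (u k) (b k)) l (𝓝 (val v β)) :=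
      tendsto_const_nhds.sub (tendsto_integral_metaAction hb hr hW ω hM huv hbβ)
    have hinner := huv (innerSL ℝ v)
    simp only [innerSL_apply_apply] at hinner
    have hlow := ((hinner.sub_const (1 / 2 * ‖v‖ ^ 2)).add hQlim).add
      ((((hvlim.const_mul (2 * D)).sub_const (D ^ 2))).const_mul (lam / 2))
    have hle := le_of_tendsto_of_tendsto hlow (hm.mono_left hl) (Eventually.of_forall fun k => by
      have := hfin (u k) (b k)
      have e1 : inner ℝ v (u k) ≤ 1 / 2 * ‖u k‖ ^ 2 + 1 / 2 * ‖v‖ ^ 2 := by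
        have := real_inner_le_norm v (u k)
        nlinarith [sq_nonneg (‖u k‖ - ‖v‖)]
      have e2 := hW.le_dualDist (metaAction (flowMap (u k : ℝ → V) 1) (fun y => b k y ^ 2)
        (discreteVarifold r x U)) μtar ω hω
      set Dk := dualDist W (metaAction (flowMap (u k : ℝ → V) 1) (fun y => b k y ^ 2)
        (discreteVarifold r x U)) μtar with hDk
      have e3 : 2 * D * val (u k) (b k) - D ^ 2 ≤ Dk ^ 2 := by
        have := mul_le_mul_of_nonneg_left e2 hD0
        nlinarith [sq_nonneg (Dk - D)]
      have e4 : m k = 1 / 2 * ‖u k‖ ^ 2 + Q (u k) (b k) + lam / 2 * Dk ^ 2 := (hub k).symm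
      have e5 := mul_le_mul_of_nonneg_left e3 (by positivity : 0 ≤ lam / 2)
      rw [e4]
      linarith)
    rw [real_inner_self_eq_norm_sq] at hle
    rw [le_div_iff₀ hlam]
    change D * val v β * lam ≤ _
    linarith
  have hDD : D ^ 2 ≤ (sInf C - 1 / 2 * ‖v‖ ^ 2 - Q v β + lam / 2 * D ^ 2) / lam := by
    have : Nonempty {ω : W // ‖ω‖ ≤ 1} := ⟨⟨0, by simp⟩⟩
    -- As `D ≥ 0`, the supremum over `ω` of `D` times the pairing is `D * D`, so the bounds for
    -- single `ω` bound `D²`.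
    have e : D ^ 2 = ⨆ ω : {ω : W // ‖ω‖ ≤ 1}, D * ((∫ z, ω.1 z ∂μtar) -
        ∫ z, ω.1 z ∂metaAction (flowMap (v : ℝ → V) 1) (fun y => β y ^ 2)
          (discreteVarifold r x U)) := by
      rw [← Real.mul_iSup_of_nonneg hD0, sq]
      rfl
    exact e.trans_le (ciSup_le hmain)
  rw [le_div_iff₀ hlam] at hDD
  change 1 / 2 * ‖v‖ ^ 2 + Q v β + lam / 2 * D ^ 2 ≤ sInf C
  linarith

end Existence

end

theorem theorem3 {n d : ℕ} (hn : 2 ≤ n) (hd : d ≤ n)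
    {V : Type*} [NormedAddCommGroup V] [InnerProductSpace ℝ V] [CompleteSpace V]
    [RKHS ℝ V (Eucl n) (Eucl n)] (hV : EmbedsC20 (n := n) V)
    {W : Type*} [NormedAddCommGroup W] [InnerProductSpace ℝ W] [CompleteSpace W]
    [RKHS ℝ W (VSpace n d) ℝ]
    (k : VSpace n d → VSpace n d → ℝ) (hk : ∀ z z', k z z' = RKHS.kernel W z z' 1)
    (hk_nonneg : ∀ z z', 0 ≤ k z z') (hk_pos : ∀ z, 0 < k z z)
    (hW : EmbedsC10 (n := n) (d := d) W)
    {γ lam : ℝ} (hγ : 0 < γ) (hlam : 0 < lam)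
    {N : ℕ} (r : Fin N → ℝ) (hr : ∀ i, 0 < r i) (x : Fin N → Eucl n) (U : Fin N → OGrass n d)
    (μ : Measure (VSpace n d)) (hμ : μ = discreteVarifold r x U)
    (μtar : Measure (VSpace n d)) [IsFiniteMeasure μtar] :
    ∃ (v : L2Time V) (η : L2Time (Lp ℝ 2 (weight μ))),
      (∀ t ∈ Icc (0 : ℝ) 1, ∀ᵐ y ∂(weight μ), 0 ≤ alphaTilde η t y) ∧
      ∀ (v' : L2Time V) (η' : L2Time (Lp ℝ 2 (weight μ))),
        relaxedCost W γ lam μ μtar v η ≤ relaxedCost W γ lam μ μtar v' η' := by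
  subst hμ
  obtain ⟨c, hb⟩ := hV.exists_hasC2Bound
  obtain ⟨v, β, hβ, hmin⟩ := exists_forall_reducedCost_le (r := r) (x := x) (U := U) hb hr hW hγ
    hlam μtar
  obtain ⟨η, hη, hcost⟩ := exists_relaxedCost_eq_reducedCost (x := x) (U := U) W hb hr γ lam μtar
    v hβ
  refine ⟨v, η, hη, fun v' η' => ?_⟩
  rw [hcost]
  -- The competitor is compared through the absolute value of its final weight, which is admissible
  -- in the reduced problem.
  exact (hmin v' _ fun _ => abs_nonneg _).trans
    (reducedCost_abs_alphaTilde_le W hb hr hγ lam μtar v' η')
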